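/- **Proposition 4.6 (energy and momentum densities).** Let $M$ be a smooth 4-manifold with a time-oriented $C^1$ Lorentzian metric $g_{ab}$ of signature $(-,+,+,+)$ and Levi-Civita connection $\nabla$. Let $u^a$ be a $C^1$ future-pointing vector field with $u_au^a=-1$, let $\epsilon>0$ be a $C^1$ function on $M$, and let $c_\epsilon>0$ and $c_\chi,c_\eta,c_\lambda\in\mathbb R$ be constants. Put $\Delta_a^b=\delta_a^b+u_au^b$ and $$\mathcal A_a=u^b\nabla_bu_a-\tfrac13(\nabla_bu^b)u_a .$$ For any metric and one-form $\mathcal A_a$, the Weyl derivative of a tensor of weight $w$ is $$\mathcal D_cT^{a\cdots}_{b\cdots}=\nabla_cT^{a\cdots}_{b\cdots}+w\mathcal A_cT^{a\cdots}_{b\cdots}+C^a_{cd}T^{d\cdots}_{b\cdots}+\cdots-C^d_{cb}T^{a\cdots}_{d\cdots}-\cdots,\qquad C^a_{bc}=g_{cb}g^{ad}\mathcal A_d-\delta^a_c\mathcal A_b-\delta^a_b\mathcal A_c ,$$ where $u^a$ has weight $1$, $u_a$ weight $-1$, $\epsilon$ weight $4$ and a temperature $T$ weight $1$. Write $\mathcal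 D=u^a\mathcal D_a$, $\mathcal D_{\langle a\rangle}=\Delta_a^b\mathcal D_b$, $\sigma_{ab}=\frac12(\mathcal D_au_b+\mathcal D_bu_a)$, and let $$T_{ab}=\Big(\epsilon+\frac{3\chi}{4\epsilon}\mathcal D\epsilon\Big)\Big(u_au_b+\tfrac13\Delta_{ab}\Big)-2\eta\,\sigma_{ab}+\frac{\lambda}{4\epsilon}\big(u_a\mathcal D_{\langle b\rangle}\epsilon+u_b\mathcal D_{\langle a\rangle}\epsilon\big),$$ where $\chi,\eta,\lambda$ are $c_\chi,c_\eta,c_\lambda$ times $(\epsilon/c_\epsilon)^{3/4}$. Let $\iota:\Sigma\to M$ be a $C^2$ immersion (for instance the inclusion of a hypersurface) of a smooth 3-manifold whose induced metric $h_{ab}$ is Riemannian, and let $N^a$ be its future-pointing unit normal (a $C^1$ field along $\iota$). Along $\Sigma$ let $h_b^c=\delta_b^c+N_bN^c$, and write $u^a=\gamma N^a+v^a$ with $v^a$ tangent to $\Sigma$ and $\gamma=\sqrt{1+|v|_h^2}$. Let $K_{ab}X^aY^b=g(\nabla_XN,Y)$ for tangential $X,Y$, let $\tau=h^{ab}K_{ab}$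 and $\theta_{ab}=K_{ab}-\frac\tau3h_{ab}$. Let $\mathcal D^\Sigma$ be the Weyl derivative on $\Sigma$ determined by $h_{ab}$ and the pullback of $\mathcal A_a$, and let $$\sigma^\Sigma_{ab}=\tfrac12(\mathcal D^\Sigma_av_b+\mathcal D^\Sigma_bv_a)-\tfrac13(\mathcal D^\Sigma_cv^c)h_{ab}$$ ($v^a$ of weight $1$, $v_a$ of weight $-1$). Tensors intrinsic to $\Sigma$ are extended so as to annihilate $N^a$. Then the energy density $\mathcal E=N^aN^bT_{ab}$ and the momentum density $\mathcal J_b=-N^ah_b^cT_{ac}$ are given on $\Sigma$ by $$\mathcal E=\Big(\epsilon+\chi\frac{3\mathcal D\epsilon}{4\epsilon}\Big)\Big(1+\tfrac43|v|_h^2\Big)-\eta\frac{6}{1+2\gamma^2}\big[\gamma\theta_{ab}+\sigma^\Sigma_{ab}\big]v^av^b+\lambda\frac{v^a}{2\epsilon}\big(\mathcal D^\Sigma_a\epsilon+v_a\mathcal D\epsilon\big),$$ $$\mathcal J_b=\Big(\epsilon+\chi\frac34\frac{\mathcal D\epsilon}{\epsilon}\Big)\frac{4\gamma}{3}v_b-\eta\frac{2v^c}{\gamma}\Big(\delta_b^d+\frac{v_bv^d}{1+2\gamma^2}\Big)\big(\gamma\theta_{cd}+\sigma^\Sigma_{cd}\big)+\lambda\frac{\gamma}{4\epsilon}\Big(\delta_b^c+\frac{v^cv_b}{\gamma^2}\Big)\big(\mathcal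 D^\Sigma_c\epsilon+v_c\mathcal D\epsilon\big).$$ Alternatively, in terms of the temperature $T>0$ with $\epsilon=c_\epsilon T^4$, $$\mathcal E=\big(c_\epsilon T^4+3c_\chi T^2\mathcal DT\big)\Big(1+\tfrac43|v|_h^2\Big)-c_\eta T^3\frac{6}{1+2\gamma^2}\big[\gamma\theta_{ab}+\sigma^\Sigma_{ab}\big]v^av^b+2c_\lambda T^2v^a\big(\mathcal D^\Sigma_aT+v_a\mathcal DT\big),$$ $$\mathcal J_b=\big(c_\epsilon T^4+3c_\chi T^2\mathcal DT\big)\frac{4\gamma}{3}v_b-2c_\eta T^3\frac{v^c}{\gamma}\Big(\delta_b^d+\frac{v_bv^d}{1+2\gamma^2}\Big)\big(\gamma\theta_{cd}+\sigma^\Sigma_{cd}\big)+c_\lambda T^2\gamma\Big(\delta_b^c+\frac{v^cv_b}{\gamma^2}\Big)\big(\mathcal D^\Sigma_cT+v_c\mathcal DT\big).$$ -/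

import Mathlib

open scoped Manifold ContDiff Bundle

noncomputable section

namespace ConformalFluid

/-! Throughout, manifolds are modelled on a finite-dimensional real vector space `E`, tensor fields
are given fibrewise, and index notation is recalled in the comments. -/

section Connection

variable {E : Type*} [NormedAddCommGroup E] [NormedSpace ℝ E]
  {M : Type*} [TopologicalSpace M] [ChartedSpace E M] [IsManifold 𝓘(ℝ, E) ∞ M]

variable (E M) in
/-- Vector fields `V^a`. -/
abbrev VecField := ∀ x : M, TangentSpace 𝓘(ℝ, E) x

variable (E M) in
/-- One-forms `α_a`. -/
abbrev OneForm := ∀ x : M, TangentSpace 𝓘(ℝ, E) x →L[ℝ] ℝ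

variable (E M) in
/-- Fields of bilinear forms `g_{ab}` on the tangent spaces. -/
abbrev BilinField :=
  ∀ x : M, TangentSpace 𝓘(ℝ, E) x →L[ℝ] TangentSpace 𝓘(ℝ, E) x →L[ℝ] ℝ

/-- Pullback of a bilinear form along a linear map: `(a, b) ↦ B (L a) (L b)`. -/
def pullbackForm {V W : Type*} [AddCommGroup V] [Module ℝ V] [TopologicalSpace V]
    [AddCommGroup W] [Module ℝ W] [TopologicalSpace W] [IsTopologicalAddGroup V]
    [IsTopologicalAddGroup W] [ContinuousConstSMul ℝ V] [ContinuousConstSMul ℝ W]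
    (B : W →L[ℝ] W →L[ℝ] ℝ) (L : V →L[ℝ] W) : V →L[ℝ] V →L[ℝ] ℝ :=
  (ContinuousLinearMap.precomp ℝ L) ∘L B ∘L L

/-- The components of a tangent vector at `y` in the coordinate frame of the chart at `x`. -/
def coord (x y : M) : TangentSpace 𝓘(ℝ, E) y →L[ℝ] E :=
  (trivializationAt E (TangentSpace 𝓘(ℝ, E)) x).continuousLinearMapAt ℝ y

/-- The tangent vector at `y` with given components in the coordinate frame of the chart at `x`. -/
def frame (x y : M) : E →L[ℝ] TangentSpace 𝓘(ℝ, E) y :=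
  (trivializationAt E (TangentSpace 𝓘(ℝ, E)) x).symmL ℝ y

/-- The components `g_{ij}(y)` in the chart at `x`. -/
def metricCoord (g : BilinField E M) (x y : M) : E →L[ℝ] E →L[ℝ] ℝ :=
  pullbackForm (g y) (frame x y)

/-- The partial derivatives of the metric at `x` in the chart at `x`:
`metricPartial g x a b c = a^k b^i c^j ∂_k g_{ij}`. -/
def metricPartial (g : BilinField E M) (x : M) : E →L[ℝ] E →L[ℝ] E →L[ℝ] ℝ :=
  mvfderiv 𝓘(ℝ, E) (metricCoord g x) x ∘L frame x x

/-- The Christoffel symbols of the first kind at `x` in the chart at `x`: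
`christoffelLow g x a b c = a^i b^j c^k (∂_i g_{jk} + ∂_j g_{ik} - ∂_k g_{ij}) / 2`. -/
def christoffelLow (g : BilinField E M) (x : M) (a : E) : E →L[ℝ] E →L[ℝ] ℝ :=
  (1 / 2 : ℝ) • (metricPartial g x a + (metricPartial g x).flip a
    - ((metricPartial g x).flip a).flip)

/-- The Christoffel symbols at `x` in the chart at `x`: `christoffel g x a b = Γ^k_{ij} a^i b^j`,
where `g_{kl} Γ^l_{ij} = (∂_i g_{jk} + ∂_j g_{ik} - ∂_k g_{ij}) / 2`. -/
def christoffel (g : BilinField E M) (x : M) (a : E) : E →L[ℝ] E :=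
  (metricCoord g x x).inverse ∘L christoffelLow g x a

lemma christoffelLow_apply (g : BilinField E M) (x : M) (a b c : E) :
    christoffelLow g x a b c = (1 / 2) * (metricPartial g x a b c + metricPartial g x b a c
      - metricPartial g x c a b) := rfl

lemma christoffel_add (g : BilinField E M) (x : M) (a b : E) :
    christoffel g x (a + b) = christoffel g x a + christoffel g x b := by
  have h : christoffelLow g x (a + b) = christoffelLow g x a + christoffelLow g x b := by
    refine ContinuousLinearMap.ext fun c => ContinuousLinearMap.ext fun d => ?_
    simp only [christoffelLow_apply, ContinuousLinearMap.map_add, add_apply]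
    ring
  rw [christoffel, h, ContinuousLinearMap.comp_add]
  rfl

lemma christoffel_smul (g : BilinField E M) (x : M) (r : ℝ) (a : E) :
    christoffel g x (r • a) = r • christoffel g x a := by
  have h : christoffelLow g x (r • a) = r • christoffelLow g x a := by
    refine ContinuousLinearMap.ext fun c => ContinuousLinearMap.ext fun d => ?_
    simp only [christoffelLow_apply, ContinuousLinearMap.map_smul, smul_apply, smul_eq_mul]
    ring
  rw [christoffel, h, ContinuousLinearMap.comp_smul]
  rfl

/-- The Levi-Civita derivative of a vector field:
`covDeriv g V x X = X^a ∇_a V^b` with `∇_i V^k = ∂_i V^k + Γ^k_{ij} V^j`. -/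
def covDeriv (g : BilinField E M) (V : VecField E M) (x : M) :
    TangentSpace 𝓘(ℝ, E) x →ₗ[ℝ] TangentSpace 𝓘(ℝ, E) x where
  toFun X := frame x x (mvfderiv 𝓘(ℝ, E) (fun y => coord x y (V y)) x X
    + christoffel g x (coord x x X) (coord x x (V x)))
  map_add' X Y := by
    simp only [map_add, christoffel_add, add_apply]
    abel
  map_smul' r X := by
    simp only [map_smul, christoffel_smul, smul_apply, map_add, smul_add,
      RingHom.id_apply]

/-- The Levi-Civita derivative of a one-form:
`covDerivForm g α x X Y = X^a Y^b ∇_a α_b` with `∇_i α_j = ∂_i α_j - Γ^k_{ij} α_k`. -/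
def covDerivForm (g : BilinField E M) (α : OneForm E M) (x : M) :
    TangentSpace 𝓘(ℝ, E) x →ₗ[ℝ] TangentSpace 𝓘(ℝ, E) x →L[ℝ] ℝ where
  toFun X := (mvfderiv 𝓘(ℝ, E) (fun y => α y ∘L frame x y) x X
    - α x ∘L frame x x ∘L christoffel g x (coord x x X)) ∘L coord x x
  map_add' X Y := by
    ext Z
    simp [christoffel_add]
    ring
  map_smul' r X := by
    ext Z
    simp [christoffel_smul]
    ring

/-- The Levi-Civita derivative `X^a ∇_a V^b` along a map `f : N → M` of a field `V` of vectors
`V p` tangent to `M` at `f p`, in a direction `X` tangent to `N`. -/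
def covDerivAlong {F : Type*} [NormedAddCommGroup F] [NormedSpace ℝ F]
    {N : Type*} [TopologicalSpace N] [ChartedSpace F N]
    (g : BilinField E M) (f : N → M) (V : ∀ p : N, TangentSpace 𝓘(ℝ, E) (f p)) (p : N) :
    TangentSpace 𝓘(ℝ, F) p →ₗ[ℝ] TangentSpace 𝓘(ℝ, E) (f p) where
  toFun X := frame (f p) (f p) (mvfderiv 𝓘(ℝ, F) (fun q => coord (f p) (f q) (V q)) p X
    + christoffel g (f p) (coord (f p) (f p) (mfderiv 𝓘(ℝ, F) 𝓘(ℝ, E) f p X))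
        (coord (f p) (f p) (V p)))
  map_add' X Y := by
    simp only [map_add, christoffel_add, add_apply]
    abel
  map_smul' r X := by
    simp only [map_smul, christoffel_smul, smul_apply, map_add, smul_add,
      RingHom.id_apply]

/-- Index raising `α_a ↦ g^{ab} α_b` at `x`. -/
def raise (g : BilinField E M) (x : M) (α : TangentSpace 𝓘(ℝ, E) x →L[ℝ] ℝ) :
    TangentSpace 𝓘(ℝ, E) x :=
  (g x).inverse α

/-- Index lowering `V^a ↦ V_a = g_{ab} V^b`. -/
def lower (g : BilinField E M) (V : VecField E M) : OneForm E M := fun x => g x (V x)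

/-! ### The Weyl derivative determined by a metric and a one-form `A_a` -/

/-- `X^b C^a_{bc}` for `C^a_{bc} = g_{cb} g^{ad} A_d - δ^a_c A_b - δ^a_b A_c`. -/
def weylC (g : BilinField E M) (A : OneForm E M) (x : M) (X : TangentSpace 𝓘(ℝ, E) x) :
    TangentSpace 𝓘(ℝ, E) x →L[ℝ] TangentSpace 𝓘(ℝ, E) x :=
  (g x X).smulRight (raise g x (A x)) - A x X • ContinuousLinearMap.id ℝ _ - (A x).smulRight X

/-- The Weyl derivative `D_a f = ∇_a f + w A_a f` of a scalar of weight `w`. -/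
def weylScalar (A : OneForm E M) (w : ℝ) (f : M → ℝ) : OneForm E M := fun x =>
  mvfderiv 𝓘(ℝ, E) f x + (w * f x) • A x

/-- The Weyl derivative of a vector field of weight `w`:
`X^c D_c V^a` with `D_c V^a = ∇_c V^a + w A_c V^a + C^a_{cd} V^d`. -/
def weylVec (g : BilinField E M) (A : OneForm E M) (w : ℝ) (V : VecField E M) (x : M) :
    TangentSpace 𝓘(ℝ, E) x →ₗ[ℝ] TangentSpace 𝓘(ℝ, E) x where
  toFun X := covDeriv g V x X + (w * A x X) • V x + weylC g A x X (V x)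
  map_add' X Y := by
    simp [weylC]
    module
  map_smul' r X := by
    simp [weylC]
    module

/-- The Weyl derivative of a one-form of weight `w`:
`X^c Y^b D_c α_b` with `D_c α_b = ∇_c α_b + w A_c α_b - C^d_{cb} α_d`. -/
def weylForm (g : BilinField E M) (A : OneForm E M) (w : ℝ) (α : OneForm E M) (x : M)
    (X Y : TangentSpace 𝓘(ℝ, E) x) : ℝ :=
  covDerivForm g α x X Y + w * A x X * α x Y - α x (weylC g A x X Y)

end Connection

/-! ### Spacetime and the fluid -/

/-- The model space of an `n`-dimensional manifold. -/
abbrev Model (n : ℕ) := EuclideanSpace ℝ (Fin n)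

section Spacetime

variable {M : Type*} [TopologicalSpace M] [ChartedSpace (Model 4) M] [IsManifold (𝓡 4) ∞ M]

variable (M) in
/-- A `C¹` Lorentzian metric of signature `(-,+,+,+)` on the 4-manifold `M`: some vector is
timelike, and the form is positive definite on its orthogonal complement. -/
structure LorentzianMetric where
  form : BilinField (Model 4) M
  symm : ∀ x X Y, form x X Y = form x Y X
  signature : ∀ x, ∃ X, form x X X < 0 ∧ ∀ Y, form x X Y = 0 → Y ≠ 0 → 0 < form x Y Y
  contMDiff : ContMDiff (𝓡 4) ((𝓡 4).prod 𝓘(ℝ, Model 4 →L[ℝ] Model 4 →L[ℝ] ℝ)) 1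
    (fun x => Bundle.TotalSpace.mk' (Model 4 →L[ℝ] Model 4 →L[ℝ] ℝ)
      (E := fun x : M => TangentSpace (𝓡 4) x →L[ℝ] TangentSpace (𝓡 4) x →L[ℝ] ℝ) x (form x))

/-- A time orientation, given by a continuous timelike vector field. -/
structure TimeOrientation (g : LorentzianMetric M) where
  field : VecField (Model 4) M
  timelike : ∀ x, g.form x (field x) (field x) < 0
  continuous : Continuous (fun x => (⟨x, field x⟩ : TangentBundle (𝓡 4) M))

/-- `X` is a future-pointing timelike vector with `g_{ab} X^a X^b = -1`. -/
def IsFutureUnit (g : LorentzianMetric M) (t : TimeOrientation g) (x : M)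
    (X : TangentSpace (𝓡 4) x) : Prop :=
  g.form x X X = -1 ∧ g.form x (t.field x) X < 0

/-- A fluid velocity: a `C¹` future-pointing unit timelike vector field. -/
structure IsFluidVelocity (g : LorentzianMetric M) (t : TimeOrientation g)
    (u : VecField (Model 4) M) : Prop where
  unit : ∀ x, IsFutureUnit g t x (u x)
  contMDiff : ContMDiff (𝓡 4) (𝓡 4).tangent 1 (fun x => (⟨x, u x⟩ : TangentBundle (𝓡 4) M))

/-- The one-form `A_a = u^b ∇_b u_a - (1/3) (∇_b u^b) u_a`. -/
def fluidA (g : BilinField (Model 4) M) (u : VecField (Model 4) M) : OneForm (Model 4) M :=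
  fun x => covDerivForm g (lower g u) x (u x)
    - ((1 / 3) * LinearMap.trace ℝ _ (covDeriv g u x)) • lower g u x

/-- The shear tensor `σ_{ab} = (D_a u_b + D_b u_a) / 2`, the one-form `u_a` having weight `-1`. -/
def shear (g : BilinField (Model 4) M) (u : VecField (Model 4) M) (x : M)
    (X Y : TangentSpace (𝓡 4) x) : ℝ :=
  (1 / 2) * (weylForm g (fluidA g u) (-1) (lower g u) x X Y
    + weylForm g (fluidA g u) (-1) (lower g u) x Y X)

/-- The derivative `D f = u^a D_a f` of a scalar `f` of weight `w` along the fluid flow. -/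
def flowD (g : BilinField (Model 4) M) (u : VecField (Model 4) M) (w : ℝ) (f : M → ℝ) (x : M) :
    ℝ :=
  weylScalar (fluidA g u) w f x (u x)

/-- The derivative `D_{<a>} f = Δ_a^b D_b f` of a scalar `f` of weight `w` orthogonal to the flow,
where `Δ_a^b = δ_a^b + u_a u^b`. -/
def perpD (g : BilinField (Model 4) M) (u : VecField (Model 4) M) (w : ℝ) (f : M → ℝ) (x : M)
    (X : TangentSpace (𝓡 4) x) : ℝ :=
  weylScalar (fluidA g u) w f x (X + lower g u x X • u x)

/-- A viscosity coefficient `c (ε / c_ε)^{3/4}`. -/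
def viscosity (c cε ε : ℝ) : ℝ := c * (ε / cε) ^ (3 / 4 : ℝ)

/-- The stress-energy tensor of a viscous conformal fluid with velocity `u^a` and rest energy
density `ε` (of weight 4), with lowered indices:
`T_{ab} = (ε + 3χ/(4ε) Dε) (u_a u_b + Δ_{ab}/3) - 2 η σ_{ab}
  + λ/(4ε) (u_a D_{<b>} ε + u_b D_{<a>} ε)`,
where `Δ_{ab} = g_{ab} + u_a u_b` and `χ, η, λ` are `c (ε / c_ε)^{3/4}` for `c = cχ, cη, cl`. -/
def stressEnergy (g : BilinField (Model 4) M) (u : VecField (Model 4) M) (ε : M → ℝ)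
    (cε cχ cη cl : ℝ) (x : M) (X Y : TangentSpace (𝓡 4) x) : ℝ :=
  (ε x + 3 * viscosity cχ cε (ε x) / (4 * ε x) * flowD g u 4 ε x)
      * (lower g u x X * lower g u x Y + (1 / 3) * (g x X Y + lower g u x X * lower g u x Y))
    - 2 * viscosity cη cε (ε x) * shear g u x X Y
    + viscosity cl cε (ε x) / (4 * ε x)
      * (lower g u x X * perpD g u 4 ε x Y + lower g u x Y * perpD g u 4 ε x X)

end Spacetime

/-! ### Spacelike hypersurfaces and the data they inherit -/

section Slice

variable {M : Type*} [TopologicalSpace M] [ChartedSpace (Model 4) M] [IsManifold (𝓡 4) ∞ M]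
  {S : Type*} [TopologicalSpace S] [ChartedSpace (Model 3) S] [IsManifold (𝓡 3) ∞ S]

/-- The induced metric `h_{ab}`: the pullback of `g_{ab}` along `ι : S → M`. -/
def inducedMetric (g : BilinField (Model 4) M) (ι : S → M) : BilinField (Model 3) S := fun p =>
  pullbackForm (g (ι p)) (mfderiv (𝓡 3) (𝓡 4) ι p)

/-- `ι : S → M` is a `C²` immersion of the 3-manifold `S` as a spacelike hypersurface, that is, the
induced metric is positive definite (which makes the differential of `ι` injective). -/
structure IsSpacelike (g : LorentzianMetric M) (ι : S → M) : Prop where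
  contMDiff : ContMDiff (𝓡 3) (𝓡 4) 2 ι
  pos : ∀ p (X : TangentSpace (𝓡 3) p), X ≠ 0 → 0 < inducedMetric g.form ι p X X

/-- `N^a` is the (`C¹`) future-pointing unit normal field of the hypersurface `ι : S → M`. -/
structure IsFutureUnitNormal (g : LorentzianMetric M) (t : TimeOrientation g) (ι : S → M)
    (N : ∀ p : S, TangentSpace (𝓡 4) (ι p)) : Prop where
  unit : ∀ p, IsFutureUnit g t (ι p) (N p)
  normal : ∀ p (X : TangentSpace (𝓡 3) p), g.form (ι p) (N p) (mfderiv (𝓡 3) (𝓡 4) ι p X) = 0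
  contMDiff : ContMDiff (𝓡 3) (𝓡 4).tangent 1 (fun p => (⟨ι p, N p⟩ : TangentBundle (𝓡 4) M))

/-- The energy density `N^a N^b T_{ab}` of a tensor `T_{ab}` on the hypersurface. -/
def energyDensity (T : ∀ x : M, TangentSpace (𝓡 4) x → TangentSpace (𝓡 4) x → ℝ) (ι : S → M)
    (N : ∀ p : S, TangentSpace (𝓡 4) (ι p)) (p : S) : ℝ :=
  T (ι p) (N p) (N p)

/-- The momentum density `Z^b J_b = - N^a h_b^c T_{ac} Z^b`, where `h_b^c = δ_b^c + N_b N^c`. -/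
def momentumDensity (g : BilinField (Model 4) M)
    (T : ∀ x : M, TangentSpace (𝓡 4) x → TangentSpace (𝓡 4) x → ℝ) (ι : S → M)
    (N : ∀ p : S, TangentSpace (𝓡 4) (ι p)) (p : S) (Z : TangentSpace (𝓡 4) (ι p)) : ℝ :=
  - T (ι p) (N p) (Z + g (ι p) (N p) Z • N p)

/-- The second fundamental form `K_{ab} X^a Y^b = g(∇_X N, Y)`; with this sign the Lie derivative
of `h_{ab}` in the direction of `N` is `+2 K_{ab}`. -/
def secondForm (g : BilinField (Model 4) M) (ι : S → M) (N : ∀ p : S, TangentSpace (𝓡 4) (ι p))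
    (p : S) : TangentSpace (𝓡 3) p →ₗ[ℝ] TangentSpace (𝓡 3) p →L[ℝ] ℝ where
  toFun X := g (ι p) (covDerivAlong g ι N p X) ∘L mfderiv (𝓡 3) (𝓡 4) ι p
  map_add' X Y := by
    ext Z
    simp
  map_smul' r X := by
    ext Z
    simp

/-- The mean curvature `τ = h^{ab} K_{ab}`. -/
def meanCurvature (g : BilinField (Model 4) M) (ι : S → M)
    (N : ∀ p : S, TangentSpace (𝓡 4) (ι p)) (p : S) : ℝ :=
  LinearMap.trace ℝ _
    ((inducedMetric g ι p).inverse.toLinearMap ∘ₗ secondForm g ι N p)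

/-- The trace-free part `θ_{ab} = K_{ab} - (τ/3) h_{ab}` of the second fundamental form. -/
def tracefreeForm (g : BilinField (Model 4) M) (ι : S → M)
    (N : ∀ p : S, TangentSpace (𝓡 4) (ι p)) (p : S) (X Y : TangentSpace (𝓡 3) p) : ℝ :=
  secondForm g ι N p X Y - meanCurvature g ι N p / 3 * inducedMetric g ι p X Y

/-- The pullback `A^Σ_a` to the hypersurface of the one-form `A_a`. -/
def sliceA (g : BilinField (Model 4) M) (u : VecField (Model 4) M) (ι : S → M) :
    OneForm (Model 3) S := fun p => fluidA g u (ι p) ∘L mfderiv (𝓡 3) (𝓡 4) ι p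

/-- The tangential part `v^a` of the fluid velocity: the vector field on the hypersurface with
`h(v, Y) = g(u, Y)` for all tangential `Y`. -/
def sliceV (g : BilinField (Model 4) M) (u : VecField (Model 4) M) (ι : S → M) :
    VecField (Model 3) S := fun p =>
  raise (inducedMetric g ι) p (g (ι p) (u (ι p)) ∘L mfderiv (𝓡 3) (𝓡 4) ι p)

/-- The square norm `|v|_h^2`. -/
def sliceNormSq (g : BilinField (Model 4) M) (u : VecField (Model 4) M) (ι : S → M) (p : S) : ℝ :=
  inducedMetric g ι p (sliceV g u ι p) (sliceV g u ι p)

/-- The factor `γ = (1 + |v|_h^2)^{1/2}`, for which `u^a = γ N^a + v^a`. -/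
def sliceGamma (g : BilinField (Model 4) M) (u : VecField (Model 4) M) (ι : S → M) (p : S) : ℝ :=
  Real.sqrt (1 + sliceNormSq g u ι p)

/-- The one-form `v_a = h_{ab} v^b`. -/
def sliceVLow (g : BilinField (Model 4) M) (u : VecField (Model 4) M) (ι : S → M) :
    OneForm (Model 3) S :=
  lower (inducedMetric g ι) (sliceV g u ι)

/-- The induced Weyl derivative `D^Σ_a f` of (the restriction of) a scalar `f` of weight `w`. -/
def sliceD (g : BilinField (Model 4) M) (u : VecField (Model 4) M) (ι : S → M) (w : ℝ)
    (f : M → ℝ) : OneForm (Model 3) S :=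
  weylScalar (sliceA g u ι) w (fun p => f (ι p))

/-- The induced shear `σ^Σ_{ab} = (D^Σ_a v_b + D^Σ_b v_a) / 2 - (1/3) (D^Σ_c v^c) h_{ab}`, where
`v_a` has weight `-1` and `v^a` has weight `1`. -/
def sliceShear (g : BilinField (Model 4) M) (u : VecField (Model 4) M) (ι : S → M) (p : S)
    (X Y : TangentSpace (𝓡 3) p) : ℝ :=
  (1 / 2) * (weylForm (inducedMetric g ι) (sliceA g u ι) (-1) (sliceVLow g u ι) p X Y
      + weylForm (inducedMetric g ι) (sliceA g u ι) (-1) (sliceVLow g u ι) p Y X)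
    - (1 / 3) * LinearMap.trace ℝ _
        (weylVec (inducedMetric g ι) (sliceA g u ι) 1 (sliceV g u ι) p)
      * inducedMetric g ι p X Y

/-- The combination `γ θ_{ab} + σ^Σ_{ab}`. -/
def sliceStrain (g : BilinField (Model 4) M) (u : VecField (Model 4) M) (ι : S → M)
    (N : ∀ p : S, TangentSpace (𝓡 4) (ι p)) (p : S) (X Y : TangentSpace (𝓡 3) p) : ℝ :=
  sliceGamma g u ι p * tracefreeForm g ι N p X Y + sliceShear g u ι p X Y

/-- The combination `D^Σ_a f + v_a D f` for a scalar `f` of weight `w`. -/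
def sliceHeat (g : BilinField (Model 4) M) (u : VecField (Model 4) M) (ι : S → M) (w : ℝ)
    (f : M → ℝ) (p : S) (X : TangentSpace (𝓡 3) p) : ℝ :=
  sliceD g u ι w f p X + sliceVLow g u ι p X * flowD g u w f (ι p)

end Slice

end ConformalFluid

end

/-! Write `u = γ N + v` along `Σ` and `F = γ θ + σ^Σ`. Two properties of the shear `σ` carry the
proof, both due to the choice of the one-form `A`: `σ` annihilates `u`
(`IsFluidVelocity.shear_self`), and it is trace-free.

On tangential vectors, the Gauss formula gives `g(∇_X u, Y) = γ K(X, Y) + h(∇^Σ_X v, Y)`, so `σ` and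
`F` differ there by a multiple of `h`. As `F` is trace-free and `tr_g σ = 0` reads `tr_h σ = σ(N,
N)`, the multiple is `σ(N, N) / 3`. This is `shear_tangential`; it obtains the multiple by splitting
`div u` along the hypersurface instead of taking a trace of `σ`.

The other components follow from `σ(u, ·) = 0`: `γ σ(N, Y) = -σ(v, Y)` and `γ σ(N, N) = -σ(N, v)`.
Taking `Y = v` and using `|v|² = γ² - 1` yields `(1 + 2γ²) σ(N, N) = 3 F(v, v)`, the source of the
denominators in the statement. The heat flux is treated in the same way: `D_{<a>} ε` annihilates `u`
and equals `D^Σ ε + v Dε` on tangential vectors, which determines its normal component. The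
densities are then the components of `T_{ab}` along `N`, and the temperature form is the power rule
for weighted scalars.

The Gauss formula is proved in the charts at `p` and `ι p`, with no extension of `N` or `v` off the
hypersurface: the Christoffel symbols of `h` are those of `g` pulled back, plus second derivatives
of `ι`, and these commute because `ι` is `C²`. -/

set_option linter.unusedSectionVars false
set_option maxSynthPendingDepth 3

noncomputable section

namespace ConformalFluid

/-! ### Product and chain rules for vector-valued functions on manifolds. -/

section Calculus

variable {E : Type*} [NormedAddCommGroup E] [NormedSpace ℝ E]
  {M : Type*} [TopologicalSpace M] [ChartedSpace E M]
  {F₁ F₂ F₃ : Type*} [NormedAddCommGroup F₁] [NormedSpace ℝ F₁]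
  [NormedAddCommGroup F₂] [NormedSpace ℝ F₂] [NormedAddCommGroup F₃] [NormedSpace ℝ F₃]

lemma mvfderiv_congr {f f' : M → F₁} {x : M} (h : f =ᶠ[nhds x] f') :
    mvfderiv 𝓘(ℝ, E) f x = mvfderiv 𝓘(ℝ, E) f' x := by
  have h0 := h.mfderiv_eq (I := 𝓘(ℝ, E)) (I' := 𝓘(ℝ, F₁))
  ext X
  exact congrArg (fun L : E →L[ℝ] F₁ => L X) h0

/-- Together with `mvfderiv_eq_fderiv_chart`, this transfers the product rule from normed spaces by
reading everything in one chart. -/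
lemma mdifferentiableAt_iff_differentiableAt_chart {f : M → F₁} {x : M} :
    MDifferentiableAt 𝓘(ℝ, E) 𝓘(ℝ, F₁) f x ↔ ContinuousAt f x ∧
      DifferentiableAt ℝ (f ∘ (extChartAt 𝓘(ℝ, E) x).symm) (extChartAt 𝓘(ℝ, E) x x) := by
  rw [mdifferentiableAt_iff]
  simp only [writtenInExtChartAt, extChartAt_model_space_eq_id, modelWithCornersSelf_coe,
    Set.range_id, differentiableWithinAt_univ, PartialEquiv.refl_coe, Function.id_comp]

lemma mvfderiv_eq_fderiv_chart {f : M → F₁} {x : M}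
    (hf : MDifferentiableAt 𝓘(ℝ, E) 𝓘(ℝ, F₁) f x) (X : TangentSpace 𝓘(ℝ, E) x) :
    mvfderiv 𝓘(ℝ, E) f x X
      = fderiv ℝ (f ∘ (extChartAt 𝓘(ℝ, E) x).symm) (extChartAt 𝓘(ℝ, E) x x) X := by
  have h := hf.mvfderiv
  have h2 : fderivWithin ℝ (writtenInExtChartAt 𝓘(ℝ, E) 𝓘(ℝ, F₁) x f) (Set.range 𝓘(ℝ, E))
      (extChartAt 𝓘(ℝ, E) x x)
      = fderiv ℝ (f ∘ (extChartAt 𝓘(ℝ, E) x).symm) (extChartAt 𝓘(ℝ, E) x x) := by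
    simp only [writtenInExtChartAt, extChartAt_model_space_eq_id, modelWithCornersSelf_coe,
      Set.range_id, fderivWithin_univ, PartialEquiv.refl_coe, Function.id_comp]
  exact congrArg (fun L : E →L[ℝ] F₁ => L X) (h.trans h2)

/-- Evaluation, composition of linear maps and scalar multiplication are all continuous bilinear, so
one Leibniz rule serves for every product below. -/
lemma mdifferentiableAt_bilin (B : F₁ →L[ℝ] F₂ →L[ℝ] F₃) {f₁ : M → F₁} {f₂ : M → F₂} {x : M}
    (h₁ : MDifferentiableAt 𝓘(ℝ, E) 𝓘(ℝ, F₁) f₁ x)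
    (h₂ : MDifferentiableAt 𝓘(ℝ, E) 𝓘(ℝ, F₂) f₂ x) :
    MDifferentiableAt 𝓘(ℝ, E) 𝓘(ℝ, F₃) (fun y => B (f₁ y) (f₂ y)) x := by
  rw [mdifferentiableAt_iff_differentiableAt_chart] at *
  refine ⟨(B.continuous.continuousAt.comp h₁.1).clm_apply h₂.1, ?_⟩
  exact (B.hasFDerivAt_of_bilinear h₁.2.hasFDerivAt h₂.2.hasFDerivAt).differentiableAt

lemma mvfderiv_bilin (B : F₁ →L[ℝ] F₂ →L[ℝ] F₃) {f₁ : M → F₁} {f₂ : M → F₂} {x : M}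
    (h₁ : MDifferentiableAt 𝓘(ℝ, E) 𝓘(ℝ, F₁) f₁ x)
    (h₂ : MDifferentiableAt 𝓘(ℝ, E) 𝓘(ℝ, F₂) f₂ x) (X : TangentSpace 𝓘(ℝ, E) x) :
    mvfderiv 𝓘(ℝ, E) (fun y => B (f₁ y) (f₂ y)) x X
      = B (mvfderiv 𝓘(ℝ, E) f₁ x X) (f₂ x) + B (f₁ x) (mvfderiv 𝓘(ℝ, E) f₂ x X) := by
  rw [mvfderiv_eq_fderiv_chart (mdifferentiableAt_bilin B h₁ h₂), mvfderiv_eq_fderiv_chart h₁,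
    mvfderiv_eq_fderiv_chart h₂]
  rw [mdifferentiableAt_iff_differentiableAt_chart] at h₁ h₂
  have h := (B.hasFDerivAt_of_bilinear h₁.2.hasFDerivAt h₂.2.hasFDerivAt).fderiv
  have hx : (extChartAt 𝓘(ℝ, E) x).symm (extChartAt 𝓘(ℝ, E) x x) = x :=
    extChartAt_to_inv (I := 𝓘(ℝ, E)) x
  change fderiv ℝ (fun y => B ((f₁ ∘ (extChartAt 𝓘(ℝ, E) x).symm) y)
    ((f₂ ∘ (extChartAt 𝓘(ℝ, E) x).symm) y)) (extChartAt 𝓘(ℝ, E) x x) X = _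
  rw [h]
  simp only [ContinuousLinearMap.precompR_apply, Function.comp_apply, hx]
  exact add_comm _ _

lemma mdifferentiableAt_clm_apply {f₁ : M → F₁ →L[ℝ] F₂} {f₂ : M → F₁} {x : M}
    (h₁ : MDifferentiableAt 𝓘(ℝ, E) 𝓘(ℝ, F₁ →L[ℝ] F₂) f₁ x)
    (h₂ : MDifferentiableAt 𝓘(ℝ, E) 𝓘(ℝ, F₁) f₂ x) :
    MDifferentiableAt 𝓘(ℝ, E) 𝓘(ℝ, F₂) (fun y => f₁ y (f₂ y)) x :=
  mdifferentiableAt_bilin (ContinuousLinearMap.id ℝ (F₁ →L[ℝ] F₂)) h₁ h₂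

lemma mvfderiv_clm_apply {f₁ : M → F₁ →L[ℝ] F₂} {f₂ : M → F₁} {x : M}
    (h₁ : MDifferentiableAt 𝓘(ℝ, E) 𝓘(ℝ, F₁ →L[ℝ] F₂) f₁ x)
    (h₂ : MDifferentiableAt 𝓘(ℝ, E) 𝓘(ℝ, F₁) f₂ x) (X : TangentSpace 𝓘(ℝ, E) x) :
    mvfderiv 𝓘(ℝ, E) (fun y => f₁ y (f₂ y)) x X
      = mvfderiv 𝓘(ℝ, E) f₁ x X (f₂ x) + f₁ x (mvfderiv 𝓘(ℝ, E) f₂ x X) :=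
  mvfderiv_bilin (ContinuousLinearMap.id ℝ (F₁ →L[ℝ] F₂)) h₁ h₂ X

/-- The chain rule for vector-valued functions. -/
lemma mvfderiv_comp_mfderiv {F : Type*} [NormedAddCommGroup F] [NormedSpace ℝ F]
    {N : Type*} [TopologicalSpace N] [ChartedSpace F N] {f : M → F₁} {i : N → M} {p : N}
    (hf : MDifferentiableAt 𝓘(ℝ, E) 𝓘(ℝ, F₁) f (i p))
    (hi : MDifferentiableAt 𝓘(ℝ, F) 𝓘(ℝ, E) i p) (X : TangentSpace 𝓘(ℝ, F) p) :
    mvfderiv 𝓘(ℝ, F) (fun q => f (i q)) p X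
      = mvfderiv 𝓘(ℝ, E) f (i p) (mfderiv 𝓘(ℝ, F) 𝓘(ℝ, E) i p X) :=
  mfderiv_comp_apply p hf hi X

end Calculus

/-! ### Coordinate frames of the tangent bundle. -/

section Frames

variable {E : Type*} [NormedAddCommGroup E] [NormedSpace ℝ E]
  {M : Type*} [TopologicalSpace M] [ChartedSpace E M] [IsManifold 𝓘(ℝ, E) ∞ M]

lemma coord_frame {x y : M} (h : y ∈ (chartAt E x).source) (e : E) :
    coord x y (frame x y e) = e :=
  Bundle.Trivialization.continuousLinearMapAt_symmL _ (by simpa using h) e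

lemma frame_coord {x y : M} (h : y ∈ (chartAt E x).source) (X : TangentSpace 𝓘(ℝ, E) y) :
    frame x y (coord x y X) = X :=
  Bundle.Trivialization.symmL_continuousLinearMapAt _ (by simpa using h) X

lemma eventually_frame_coord (x : M) :
    ∀ᶠ y in nhds x, (∀ X : TangentSpace 𝓘(ℝ, E) y, frame x y (coord x y X) = X) ∧
      ∀ e : E, coord x y (frame x y e) = e := by
  filter_upwards [(chartAt E x).open_source.mem_nhds (mem_chart_source E x)] with y hy
  exact ⟨frame_coord hy, coord_frame hy⟩

lemma frame_coord_self (x : M) (X : TangentSpace 𝓘(ℝ, E) x) : frame x x (coord x x X) = X :=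
  frame_coord (mem_chart_source E x) X

/-- The coordinate frame at `x` of the chart at `x` is the identity of the model space. -/
lemma frame_self (x : M) (e : E) : frame x x e = (show TangentSpace 𝓘(ℝ, E) x from e) := by
  rw [frame, TangentBundle.symmL_trivializationAt_eq_core (mem_chart_source E x)]
  exact tangentCoordChange_self (I := 𝓘(ℝ, E)) (by simp)

end Frames

/-! ### Metric compatibility of the Levi-Civita connection. -/

section LeviCivita

variable {E : Type*} [NormedAddCommGroup E] [NormedSpace ℝ E]
  {M : Type*} [TopologicalSpace M] [ChartedSpace E M] [IsManifold 𝓘(ℝ, E) ∞ M]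
  {g : BilinField E M} {x : M}

lemma metricCoord_apply (g : BilinField E M) (x y : M) (a b : E) :
    metricCoord g x y a b = g y (frame x y a) (frame x y b) := rfl

/-- Evaluation at constant vectors commutes with differentiation, so the symmetry of `g` at all
points passes to its derivative. -/
lemma metricPartial_symm (hs : ∀ y X Y, g y X Y = g y Y X)
    (hg : MDifferentiableAt 𝓘(ℝ, E) 𝓘(ℝ, E →L[ℝ] E →L[ℝ] ℝ) (metricCoord g x) x) (a b c : E) :
    metricPartial g x a b c = metricPartial g x a c b := by
  have key : ∀ b c : E, mvfderiv 𝓘(ℝ, E) (fun y => metricCoord g x y b c) x (frame x x a)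
      = metricPartial g x a b c := by
    intro b c
    have hc : ∀ e : E, MDifferentiableAt 𝓘(ℝ, E) 𝓘(ℝ, E) (fun _ : M => e) x :=
      fun e => mdifferentiableAt_const
    rw [mvfderiv_clm_apply (mdifferentiableAt_clm_apply hg (hc b)) (hc c),
      mvfderiv_clm_apply hg (hc b), mvfderiv_const, mvfderiv_const]
    simp [metricPartial]
  rw [← key, ← key]
  congr 2
  ext y
  exact hs _ _ _

/-- Invertibility matters here: `inverse` is zero by default on non-invertible maps, and only for a
nondegenerate metric does it raise the index. -/
lemma metricCoord_christoffel (hi : (metricCoord g x x).IsInvertible) (a b : E) :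
    metricCoord g x x (christoffel g x a b) = christoffelLow g x a b := by
  simp only [christoffel, ContinuousLinearMap.comp_apply]
  exact hi.self_apply_inverse _

/-- In coordinates, the Levi-Civita connection is compatible with the metric. -/
lemma metricCoord_christoffel_add (hs : ∀ y X Y, g y X Y = g y Y X)
    (hg : MDifferentiableAt 𝓘(ℝ, E) 𝓘(ℝ, E →L[ℝ] E →L[ℝ] ℝ) (metricCoord g x) x)
    (hi : (metricCoord g x x).IsInvertible) (a b c : E) :
    metricCoord g x x (christoffel g x a b) c + metricCoord g x x b (christoffel g x a c)
      = metricPartial g x a b c := by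
  rw [metricCoord_apply g x x b, hs, ← metricCoord_apply, metricCoord_christoffel hi,
    metricCoord_christoffel hi, christoffelLow_apply, christoffelLow_apply,
    metricPartial_symm hs hg c, metricPartial_symm hs hg a c b]
  ring

lemma metric_covDeriv (g : BilinField E M) (V : VecField E M) (X Y : TangentSpace 𝓘(ℝ, E) x) :
    g x (covDeriv g V x X) Y
      = metricCoord g x x (mvfderiv 𝓘(ℝ, E) (fun y => coord x y (V y)) x X
          + christoffel g x (coord x x X) (coord x x (V x))) (coord x x Y) := by
  rw [metricCoord_apply, frame_coord_self]
  rfl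

/-- Lowering an index commutes with the Levi-Civita derivative. -/
lemma covDerivForm_lower (hs : ∀ y X Y, g y X Y = g y Y X)
    (hg : MDifferentiableAt 𝓘(ℝ, E) 𝓘(ℝ, E →L[ℝ] E →L[ℝ] ℝ) (metricCoord g x) x)
    (hi : (metricCoord g x x).IsInvertible) {V : VecField E M}
    (hV : MDifferentiableAt 𝓘(ℝ, E) 𝓘(ℝ, E) (fun y => coord x y (V y)) x)
    (X Y : TangentSpace 𝓘(ℝ, E) x) :
    covDerivForm g (lower g V) x X Y = g x (covDeriv g V x X) Y := by
  have h1 : (fun y => lower g V y ∘L frame x y)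
      =ᶠ[nhds x] fun y => metricCoord g x y (coord x y (V y)) := by
    filter_upwards [eventually_frame_coord (E := E) x] with y hy
    ext e
    simp [metricCoord_apply, hy.1, lower]
  have h2 : mvfderiv 𝓘(ℝ, E) (metricCoord g x) x X = metricPartial g x (coord x x X) := by
    simp [metricPartial, frame_coord_self]
  -- Differentiating `g_{ij} V^j` produces a `∂g` term. Metric compatibility splits it in two: one
  -- half completes `∂V` to `∇V`, the other cancels the Christoffel term in the derivative of the
  -- form.
  have h3 := metricCoord_christoffel_add hs hg hi (coord x x X) (coord x x (V x)) (coord x x Y)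
  rw [metric_covDeriv]
  change (mvfderiv 𝓘(ℝ, E) (fun y => lower g V y ∘L frame x y) x X) (coord x x Y)
    - g x (V x) (frame x x (christoffel g x (coord x x X) (coord x x Y))) = _
  have h4 : g x (V x) (frame x x (christoffel g x (coord x x X) (coord x x Y)))
      = metricCoord g x x (coord x x (V x)) (christoffel g x (coord x x X) (coord x x Y)) := by
    rw [metricCoord_apply, frame_coord_self]
  rw [mvfderiv_congr h1, mvfderiv_clm_apply hg hV, h2, h4, add_apply, ← h3, map_add, add_apply]
  ring

/-- The derivative of a vector field of constant square is orthogonal to it. -/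
lemma metric_covDeriv_self (hs : ∀ y X Y, g y X Y = g y Y X)
    (hg : MDifferentiableAt 𝓘(ℝ, E) 𝓘(ℝ, E →L[ℝ] E →L[ℝ] ℝ) (metricCoord g x) x)
    (hi : (metricCoord g x x).IsInvertible) {V : VecField E M}
    (hV : MDifferentiableAt 𝓘(ℝ, E) 𝓘(ℝ, E) (fun y => coord x y (V y)) x)
    {c : ℝ} (hc : ∀ y, g y (V y) (V y) = c) (X : TangentSpace 𝓘(ℝ, E) x) :
    g x (covDeriv g V x X) (V x) = 0 := by
  have h1 : (fun y => metricCoord g x y (coord x y (V y)) (coord x y (V y)))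
      =ᶠ[nhds x] fun _ => c := by
    filter_upwards [eventually_frame_coord (E := E) x] with y hy
    rw [metricCoord_apply, hy.1, hc]
  have h2 : mvfderiv 𝓘(ℝ, E) (metricCoord g x) x X = metricPartial g x (coord x x X) := by
    simp [metricPartial, frame_coord_self]
  have h3 := metricCoord_christoffel_add hs hg hi (coord x x X) (coord x x (V x)) (coord x x (V x))
  -- The derivative of the constant is `∂g(V, V) + 2 g(∂V, V) = 0`, and compatibility turns `∂g(V,
  -- V)` into `2 g(ΓV, V)`.
  have h4 := congrArg (fun L => L X) (mvfderiv_congr h1)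
  rw [mvfderiv_const] at h4
  simp only [zero_apply] at h4
  rw [mvfderiv_clm_apply (mdifferentiableAt_clm_apply hg hV) hV, mvfderiv_clm_apply hg hV, h2] at h4
  have h5 : ∀ a b, metricCoord g x x a b = metricCoord g x x b a := fun a b => hs _ _ _
  rw [metric_covDeriv, map_add, add_apply]
  rw [h5 (coord x x (V x)) (christoffel g x _ _)] at h3
  rw [add_apply, h5 (coord x x (V x)) (mvfderiv _ _ _ _)] at h4
  linarith

end LeviCivita

/-! ### The induced metric and the Gauss formula. -/

section Pullback

variable {E : Type*} [NormedAddCommGroup E] [NormedSpace ℝ E]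
  {M : Type*} [TopologicalSpace M] [ChartedSpace E M] [IsManifold 𝓘(ℝ, E) ∞ M]
  {F : Type*} [NormedAddCommGroup F] [NormedSpace ℝ F]
  {S : Type*} [TopologicalSpace S] [ChartedSpace F S] [IsManifold 𝓘(ℝ, F) ∞ S]
  {g : BilinField E M} {ι : S → M} {p : S}

/-- The pullback of a field of bilinear forms along a map. -/
def pullbackField (g : BilinField E M) (ι : S → M) : BilinField F S := fun p =>
  pullbackForm (g (ι p)) (mfderiv 𝓘(ℝ, F) 𝓘(ℝ, E) ι p)

lemma pullbackField_apply (g : BilinField E M) (ι : S → M) (p : S)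
    (X Y : TangentSpace 𝓘(ℝ, F) p) :
    pullbackField g ι p X Y
      = g (ι p) (mfderiv 𝓘(ℝ, F) 𝓘(ℝ, E) ι p X) (mfderiv 𝓘(ℝ, F) 𝓘(ℝ, E) ι p Y) := rfl

variable (F E) in
/-- The Jacobian of `ι` at `q` in the charts at `p` and `ι p`. -/
def jacobian (ι : S → M) (p q : S) : F →L[ℝ] E :=
  coord (ι p) (ι q) ∘L mfderiv 𝓘(ℝ, F) 𝓘(ℝ, E) ι q ∘L frame p q

lemma jacobian_apply (ι : S → M) (p q : S) (a : F) :
    jacobian E F ι p q a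
      = coord (ι p) (ι q) (mfderiv 𝓘(ℝ, F) 𝓘(ℝ, E) ι q (frame p q a)) := rfl

lemma jacobian_coord_self (ι : S → M) (p : S) (X : TangentSpace 𝓘(ℝ, F) p) :
    jacobian E F ι p p (coord p p X) = coord (ι p) (ι p) (mfderiv 𝓘(ℝ, F) 𝓘(ℝ, E) ι p X) := by
  rw [jacobian_apply, frame_coord_self]

lemma mdifferentiableAt_jacobian (hι : ContMDiffAt 𝓘(ℝ, F) 𝓘(ℝ, E) 2 ι p) :
    MDifferentiableAt 𝓘(ℝ, F) 𝓘(ℝ, F →L[ℝ] E) (jacobian E F ι p) p := by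
  have h := ContMDiffAt.mfderiv_const (m := 1) hι (by norm_num)
  exact h.mdifferentiableAt (by norm_num)

/-- Second partial derivatives commute. -/
lemma mvfderiv_jacobian_symm (hι : ContMDiffAt 𝓘(ℝ, F) 𝓘(ℝ, E) 2 ι p) (a b : F) :
    mvfderiv 𝓘(ℝ, F) (jacobian E F ι p) p (frame p p a) b
      = mvfderiv 𝓘(ℝ, F) (jacobian E F ι p) p (frame p p b) a := by
  -- `c` is `ι` read in the two charts. The Jacobian agrees with the Fréchet derivative of `c` on a
  -- whole neighbourhood, so its derivative is the second derivative of `c`, which is symmetric for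
  -- a `C²` map.
  set c : F → E := extChartAt 𝓘(ℝ, E) (ι p) ∘ ι ∘ (extChartAt 𝓘(ℝ, F) p).symm with hc
  have hc2 : ContDiffAt ℝ 2 c (extChartAt 𝓘(ℝ, F) p p) := by
    have := (contMDiffAt_iff.1 hι).2
    simp only [modelWithCornersSelf_coe, Set.range_id] at this
    exact contDiffWithinAt_univ.1 this
  have hev : (jacobian E F ι p ∘ (extChartAt 𝓘(ℝ, F) p).symm)
      =ᶠ[nhds (extChartAt 𝓘(ℝ, F) p p)] fderiv ℝ c := by
    have hcont := hι.continuousAt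
    have h0 : ∀ᶠ q in nhds p, q ∈ (extChartAt 𝓘(ℝ, F) p).source ∧
        ι q ∈ (chartAt E (ι p)).source ∧ ContMDiffAt 𝓘(ℝ, F) 𝓘(ℝ, E) 2 ι q :=
      Filter.Eventually.and (extChartAt_source_mem_nhds (I := 𝓘(ℝ, F)) p)
        ((hcont.eventually ((chartAt E (ι p)).open_source.mem_nhds (mem_chart_source E _))).and
          ((contMDiffAt_iff_contMDiffAt_nhds (by simp)).1 hι))
    have h1 : ∀ᶠ z in nhds (extChartAt 𝓘(ℝ, F) p p), z ∈ (extChartAt 𝓘(ℝ, F) p).target := by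
      simpa using extChartAt_target_mem_nhds (I := 𝓘(ℝ, F)) p
    have hcs : Filter.Tendsto (extChartAt 𝓘(ℝ, F) p).symm (nhds (extChartAt 𝓘(ℝ, F) p p))
        (nhds p) := by
      simpa [ContinuousAt] using continuousAt_extChartAt_symm (I := 𝓘(ℝ, F)) p
    filter_upwards [h1, hcs.eventually h0] with z hz hq
    obtain ⟨hq1, hq2, hq3⟩ := hq
    set q := (extChartAt 𝓘(ℝ, F) p).symm z with hqdef
    have hzq : extChartAt 𝓘(ℝ, F) p q = z := (extChartAt 𝓘(ℝ, F) p).right_inv hz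
    have e1 : jacobian E F ι p q = _ := inTangentCoordinates_eq_mfderiv_comp (I := 𝓘(ℝ, F))
      (I' := 𝓘(ℝ, E)) (f := id) (g := ι) (ϕ := fun q => mfderiv 𝓘(ℝ, F) 𝓘(ℝ, E) ι q)
      (x₀ := p) (x := q) (by simpa using hq1) hq2
    have d1 : MDifferentiableAt 𝓘(ℝ, F) 𝓘(ℝ, F) (extChartAt 𝓘(ℝ, F) p).symm z := by
      have := mdifferentiableWithinAt_extChartAt_symm (I := 𝓘(ℝ, F)) hz
      simp only [modelWithCornersSelf_coe, Set.range_id] at this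
      exact mdifferentiableWithinAt_univ.1 this
    have d2 : MDifferentiableAt 𝓘(ℝ, F) 𝓘(ℝ, E) ι q := hq3.mdifferentiableAt (by norm_num)
    have d3 : MDifferentiableAt 𝓘(ℝ, E) 𝓘(ℝ, E) (extChartAt 𝓘(ℝ, E) (ι p)) (ι q) :=
      mdifferentiableAt_extChartAt hq2
    have e2 : mfderiv 𝓘(ℝ, F) 𝓘(ℝ, E) c z = (mfderiv 𝓘(ℝ, E) 𝓘(ℝ, E)
        (extChartAt 𝓘(ℝ, E) (ι p)) (ι q)).comp ((mfderiv 𝓘(ℝ, F) 𝓘(ℝ, E) ι q).comp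
          (mfderiv 𝓘(ℝ, F) 𝓘(ℝ, F) (extChartAt 𝓘(ℝ, F) p).symm z)) := by
      have d4 : MDifferentiableAt 𝓘(ℝ, F) 𝓘(ℝ, E) (ι ∘ (extChartAt 𝓘(ℝ, F) p).symm) z :=
        MDifferentiableAt.comp z d2 d1
      have e3 := mfderiv_comp z d3 d4
      have e4 := mfderiv_comp (I' := 𝓘(ℝ, F)) z d2 d1
      exact e3.trans (congrArg _ e4)
    change jacobian E F ι p q = _
    rw [e1, ← mfderiv_eq_fderiv, e2]
    simp only [modelWithCornersSelf_coe, Set.range_id, mfderivWithin_univ, id]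
    congr 3
  have hs := hc2.isSymmSndFDerivAt (by simp)
  rw [mvfderiv_eq_fderiv_chart (mdifferentiableAt_jacobian hι),
    mvfderiv_eq_fderiv_chart (mdifferentiableAt_jacobian hι), hev.fderiv_eq, frame_self, frame_self]
  exact hs a b

lemma eventually_frame_coord_comp (hι : ContinuousAt ι p) :
    ∀ᶠ q in nhds p, ∀ X : TangentSpace 𝓘(ℝ, E) (ι q),
      frame (ι p) (ι q) (coord (ι p) (ι q) X) = X := by
  filter_upwards [hι.eventually (eventually_frame_coord (E := E) (ι p))] with q hq
  exact hq.1

lemma metricCoord_pullbackField (hι : ContinuousAt ι p) :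
    metricCoord (pullbackField (F := F) g ι) p
      =ᶠ[nhds p] fun q => pullbackForm (metricCoord g (ι p) (ι q)) (jacobian E F ι p q) := by
  filter_upwards [eventually_frame_coord_comp (E := E) hι] with q hq
  ext a b
  rw [metricCoord_apply, pullbackField_apply]
  change _ = metricCoord g (ι p) (ι q) (jacobian E F ι p q a) (jacobian E F ι p q b)
  rw [metricCoord_apply, jacobian_apply, jacobian_apply, hq, hq]

lemma mdifferentiableAt_metricCoord_comp
    (hg : MDifferentiableAt 𝓘(ℝ, E) 𝓘(ℝ, E →L[ℝ] E →L[ℝ] ℝ) (metricCoord g (ι p)) (ι p))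
    (hι : ContMDiffAt 𝓘(ℝ, F) 𝓘(ℝ, E) 2 ι p) :
    MDifferentiableAt 𝓘(ℝ, F) 𝓘(ℝ, E →L[ℝ] E →L[ℝ] ℝ) (fun q => metricCoord g (ι p) (ι q)) p :=
  MDifferentiableAt.comp p hg (hι.mdifferentiableAt (by norm_num))

/-- Precomposition in the second argument of a bilinear form. -/
def precompSecond (F E : Type*) [NormedAddCommGroup E] [NormedSpace ℝ E]
    [NormedAddCommGroup F] [NormedSpace ℝ F] :
    (F →L[ℝ] E) →L[ℝ] (F →L[ℝ] E →L[ℝ] ℝ) →L[ℝ] (F →L[ℝ] F →L[ℝ] ℝ) :=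
  (ContinuousLinearMap.compL ℝ F (E →L[ℝ] ℝ) (F →L[ℝ] ℝ)) ∘L (ContinuousLinearMap.compL ℝ F E ℝ).flip

lemma precompSecond_apply (A : F →L[ℝ] E →L[ℝ] ℝ) (L : F →L[ℝ] E) (a b : F) :
    precompSecond F E L A a b = A a (L b) := rfl

/-- Displays the pullback, quadratic in `L`, as two nested bilinear operations, so that
`mvfderiv_bilin` applies twice. -/
lemma pullbackForm_eq (B : E →L[ℝ] E →L[ℝ] ℝ) (L : F →L[ℝ] E) :
    pullbackForm B L
      = precompSecond F E L (ContinuousLinearMap.compL ℝ F E (E →L[ℝ] ℝ) B L) := rfl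

lemma mdifferentiableAt_metricCoord_pullbackField
    (hg : MDifferentiableAt 𝓘(ℝ, E) 𝓘(ℝ, E →L[ℝ] E →L[ℝ] ℝ) (metricCoord g (ι p)) (ι p))
    (hι : ContMDiffAt 𝓘(ℝ, F) 𝓘(ℝ, E) 2 ι p) :
    MDifferentiableAt 𝓘(ℝ, F) 𝓘(ℝ, F →L[ℝ] F →L[ℝ] ℝ)
      (metricCoord (pullbackField (F := F) g ι) p) p := by
  refine MDifferentiableAt.congr_of_eventuallyEq ?_ (metricCoord_pullbackField hι.continuousAt)
  simp only [pullbackForm_eq]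
  have hG := mdifferentiableAt_metricCoord_comp hg hι
  have hD := mdifferentiableAt_jacobian hι
  exact mdifferentiableAt_bilin _ hD (mdifferentiableAt_bilin _ hG hD)

/-- The Leibniz rule for `h_{ij} = g_{kl} J^k_i J^l_j`: a chain rule term for `g`, and a second
derivative of `ι` for each Jacobian. -/
lemma metricPartial_pullbackField
    (hg : MDifferentiableAt 𝓘(ℝ, E) 𝓘(ℝ, E →L[ℝ] E →L[ℝ] ℝ) (metricCoord g (ι p)) (ι p))
    (hι : ContMDiffAt 𝓘(ℝ, F) 𝓘(ℝ, E) 2 ι p) (a b c : F) :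
    metricPartial (pullbackField (F := F) g ι) p a b c
      = metricPartial g (ι p) (jacobian E F ι p p a) (jacobian E F ι p p b) (jacobian E F ι p p c)
        + metricCoord g (ι p) (ι p) (mvfderiv 𝓘(ℝ, F) (jacobian E F ι p) p (frame p p a) b)
            (jacobian E F ι p p c)
        + metricCoord g (ι p) (ι p) (jacobian E F ι p p b)
            (mvfderiv 𝓘(ℝ, F) (jacobian E F ι p) p (frame p p a) c) := by
  have hG := mdifferentiableAt_metricCoord_comp hg hι
  have hD := mdifferentiableAt_jacobian hι
  have h1 : mvfderiv 𝓘(ℝ, F) (fun q => metricCoord g (ι p) (ι q)) p (frame p p a)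
      = metricPartial g (ι p) (jacobian E F ι p p a) := by
    rw [mvfderiv_comp_mfderiv hg (hι.mdifferentiableAt (by norm_num)), jacobian_apply]
    simp [metricPartial, frame_coord_self]
  change mvfderiv 𝓘(ℝ, F) (metricCoord (pullbackField (F := F) g ι) p) p (frame p p a) b c = _
  rw [mvfderiv_congr (metricCoord_pullbackField hι.continuousAt)]
  simp only [pullbackForm_eq]
  rw [mvfderiv_bilin _ hD (mdifferentiableAt_bilin _ hG hD), mvfderiv_bilin _ hG hD, h1]
  simp only [add_apply, map_add, precompSecond_apply, ContinuousLinearMap.compL_apply,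
    ContinuousLinearMap.comp_apply]
  ring

/-- The Christoffel symbols of an induced metric. -/
lemma christoffelLow_pullbackField (hs : ∀ y X Y, g y X Y = g y Y X)
    (hg : MDifferentiableAt 𝓘(ℝ, E) 𝓘(ℝ, E →L[ℝ] E →L[ℝ] ℝ) (metricCoord g (ι p)) (ι p))
    (hι : ContMDiffAt 𝓘(ℝ, F) 𝓘(ℝ, E) 2 ι p) (a b c : F) :
    christoffelLow (pullbackField (F := F) g ι) p a b c
      = christoffelLow g (ι p) (jacobian E F ι p p a) (jacobian E F ι p p b) (jacobian E F ι p p c)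
        + metricCoord g (ι p) (ι p) (mvfderiv 𝓘(ℝ, F) (jacobian E F ι p) p (frame p p a) b)
            (jacobian E F ι p p c) := by
  have h5 : ∀ a b, metricCoord g (ι p) (ι p) a b = metricCoord g (ι p) (ι p) b a :=
    fun a b => hs _ _ _
  simp only [christoffelLow_apply, metricPartial_pullbackField hg hι]
  -- Six second-derivative terms occur. By symmetry four of them cancel and the remaining two
  -- coincide.
  rw [mvfderiv_jacobian_symm hι b a, mvfderiv_jacobian_symm (E := E) (F := F) hι c a, mvfderiv_jacobian_symm (E := E) (F := F) hι c b,
    h5 (jacobian E F ι p p a), h5 (jacobian E F ι p p b)]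
  ring

/-- The derivative along `ι` of the restriction of a vector field. -/
lemma covDerivAlong_restrict {u : VecField E M}
    (hu : MDifferentiableAt 𝓘(ℝ, E) 𝓘(ℝ, E) (fun y => coord (ι p) y (u y)) (ι p))
    (hι : MDifferentiableAt 𝓘(ℝ, F) 𝓘(ℝ, E) ι p) (X : TangentSpace 𝓘(ℝ, F) p) :
    covDerivAlong g ι (fun q => u (ι q)) p X
      = covDeriv g u (ι p) (mfderiv 𝓘(ℝ, F) 𝓘(ℝ, E) ι p X) := by
  have h := mvfderiv_comp_mfderiv hu hι X
  change frame (ι p) (ι p) (mvfderiv 𝓘(ℝ, F) (fun q => coord (ι p) (ι q) (u (ι q))) p X + _) = _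
  rw [h]
  rfl

/-- The Gauss formula, for a vector field along `ι` with a normal and a tangential component. -/
lemma metric_covDerivAlong_add (hs : ∀ y X Y, g y X Y = g y Y X)
    (hg : MDifferentiableAt 𝓘(ℝ, E) 𝓘(ℝ, E →L[ℝ] E →L[ℝ] ℝ) (metricCoord g (ι p)) (ι p))
    (hi : (metricCoord g (ι p) (ι p)).IsInvertible)
    (hh : (metricCoord (pullbackField (F := F) g ι) p p).IsInvertible)
    (hι : ContMDiffAt 𝓘(ℝ, F) 𝓘(ℝ, E) 2 ι p)
    {γ : S → ℝ} (hγ : MDifferentiableAt 𝓘(ℝ, F) 𝓘(ℝ, ℝ) γ p)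
    {N : ∀ q : S, TangentSpace 𝓘(ℝ, E) (ι q)}
    (hN : MDifferentiableAt 𝓘(ℝ, F) 𝓘(ℝ, E) (fun q => coord (ι p) (ι q) (N q)) p)
    {v : VecField F S}
    (hv : MDifferentiableAt 𝓘(ℝ, F) 𝓘(ℝ, F) (fun q => coord p q (v q)) p)
    (X Y : TangentSpace 𝓘(ℝ, F) p)
    (hY : g (ι p) (N p) (mfderiv 𝓘(ℝ, F) 𝓘(ℝ, E) ι p Y) = 0) :
    g (ι p) (covDerivAlong g ι (fun q => γ q • N q + mfderiv 𝓘(ℝ, F) 𝓘(ℝ, E) ι q (v q)) p X)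
        (mfderiv 𝓘(ℝ, F) 𝓘(ℝ, E) ι p Y)
      = γ p * g (ι p) (covDerivAlong g ι N p X) (mfderiv 𝓘(ℝ, F) 𝓘(ℝ, E) ι p Y)
        + pullbackField g ι p (covDeriv (pullbackField g ι) v p X) Y := by
  have hD := mdifferentiableAt_jacobian hι
  have along : ∀ V : ∀ q : S, TangentSpace 𝓘(ℝ, E) (ι q),
      g (ι p) (covDerivAlong g ι V p X) (mfderiv 𝓘(ℝ, F) 𝓘(ℝ, E) ι p Y)
        = metricCoord g (ι p) (ι p) (mvfderiv 𝓘(ℝ, F) (fun q => coord (ι p) (ι q) (V q)) p X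
          + christoffel g (ι p) (jacobian E F ι p p (coord p p X)) (coord (ι p) (ι p) (V p)))
            (jacobian E F ι p p (coord p p Y)) := by
    intro V
    rw [metricCoord_apply, jacobian_coord_self, jacobian_coord_self, frame_coord_self]
    rfl
  have hev : (fun q => coord (ι p) (ι q) (γ q • N q + mfderiv 𝓘(ℝ, F) 𝓘(ℝ, E) ι q (v q)))
      =ᶠ[nhds p] fun q => γ q • coord (ι p) (ι q) (N q) + jacobian E F ι p q (coord p q (v q)) := by
    filter_upwards [eventually_frame_coord (E := F) p] with q hq
    rw [map_add, map_smul, jacobian_apply, hq.1]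
  have hN0 : metricCoord g (ι p) (ι p) (coord (ι p) (ι p) (N p)) (jacobian E F ι p p (coord p p Y))
      = 0 := by
    rw [metricCoord_apply, jacobian_coord_self, frame_coord_self, frame_coord_self, hY]
  have hH : ∀ a b : F, metricCoord (pullbackField (F := F) g ι) p p a b
      = metricCoord g (ι p) (ι p) (jacobian E F ι p p a) (jacobian E F ι p p b) := by
    intro a b
    rw [(metricCoord_pullbackField hι.continuousAt).self_of_nhds]
    rfl
  -- Of the four terms, the one with the derivative of `γ` is normal and drops out against `Y`. The
  -- one with the derivative of the Jacobian is exactly the difference between the Christoffel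
  -- symbols of `h` and the pulled back ones of `g`.
  have hsum : mvfderiv 𝓘(ℝ, F) (fun q => γ q • coord (ι p) (ι q) (N q)
        + jacobian E F ι p q (coord p q (v q))) p X
      = (mvfderiv 𝓘(ℝ, F) γ p X • coord (ι p) (ι p) (N p)
          + γ p • mvfderiv 𝓘(ℝ, F) (fun q => coord (ι p) (ι q) (N q)) p X)
        + (mvfderiv 𝓘(ℝ, F) (jacobian E F ι p) p X (coord p p (v p))
          + jacobian E F ι p p (mvfderiv 𝓘(ℝ, F) (fun q => coord p q (v q)) p X)) := by
    rw [← mvfderiv_clm_apply hD hv]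
    have h1 := mvfderiv_bilin (ContinuousLinearMap.lsmul ℝ ℝ) hγ hN X
    have h2 := mvfderiv_fun_add (I := 𝓘(ℝ, F))
      (mdifferentiableAt_bilin (ContinuousLinearMap.lsmul ℝ ℝ) hγ hN)
      (mdifferentiableAt_clm_apply hD hv)
    have h3 := congrArg (fun L => L X) h2
    simp only [add_apply] at h3
    rw [h1] at h3
    exact h3
  rw [along, along, mvfderiv_congr hev, metric_covDeriv, hsum, map_add (coord (ι p) (ι p)),
    map_smul (coord (ι p) (ι p)), ← jacobian_coord_self]
  simp only [map_add, map_smul, add_apply, smul_apply, smul_eq_mul, hN0,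
    metricCoord_christoffel hh, christoffelLow_pullbackField hs hg hι,
    metricCoord_christoffel hi, hH, frame_coord_self]
  ring

end Pullback

/-! ### Lorentzian linear algebra and the trace in codimension one. -/

section LinearAlgebra

lemma isInvertible_of_nondegenerate {E : Type*} [NormedAddCommGroup E] [NormedSpace ℝ E]
    [FiniteDimensional ℝ E] (B : E →L[ℝ] E →L[ℝ] ℝ) (h : ∀ a, (∀ b, B a b = 0) → a = 0) :
    B.IsInvertible := by
  have hinj : Function.Injective B.toLinearMap := by
    rw [← LinearMap.ker_eq_bot, LinearMap.ker_eq_bot']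
    intro a ha
    exact h a fun b => congrArg (fun L : E →L[ℝ] ℝ => L b) ha
  have hdim : Module.finrank ℝ E = Module.finrank ℝ (E →L[ℝ] ℝ) := by
    rw [← (LinearMap.toContinuousLinearMap (𝕜 := ℝ) (E := E) (F' := ℝ)).finrank_eq]
    exact (Subspace.dual_finrank_eq).symm
  exact ⟨(LinearEquiv.ofInjectiveOfFinrankEq B.toLinearMap hinj hdim).toContinuousLinearEquiv, by
    ext a b; rfl⟩

variable {V W : Type*} [AddCommGroup V] [Module ℝ V] [TopologicalSpace V]
  [IsTopologicalAddGroup V] [ContinuousConstSMul ℝ V] [AddCommGroup W] [Module ℝ W]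
  [TopologicalSpace W] [IsTopologicalAddGroup W] [ContinuousConstSMul ℝ W]
  {B : V →L[ℝ] V →L[ℝ] ℝ}

/-- The signature condition: some vector is timelike, and the form is positive definite on its
orthogonal complement. -/
def IsLorentzian (B : V →L[ℝ] V →L[ℝ] ℝ) : Prop :=
  ∃ X, B X X < 0 ∧ ∀ Y, B X Y = 0 → Y ≠ 0 → 0 < B Y Y

lemma IsLorentzian.nondegenerate (hs : ∀ X Y, B X Y = B Y X) (hB : IsLorentzian B) (X : V)
    (hX : ∀ Y, B X Y = 0) : X = 0 := by
  obtain ⟨X₀, -, h⟩ := hB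
  by_contra hne
  have := h X (by rw [hs, hX]) hne
  rw [hX] at this
  exact lt_irrefl _ this

/-- A Lorentzian form is positive definite on the orthogonal complement of a timelike vector. -/
lemma IsLorentzian.pos_of_orthogonal (hs : ∀ X Y, B X Y = B Y X) (hB : IsLorentzian B) {X Y : V}
    (hX : B X X < 0) (hXY : B X Y = 0) (hY : Y ≠ 0) : 0 < B Y Y := by
  obtain ⟨X₀, h0, h⟩ := hB
  by_contra! hle
  have ha : B X₀ X ≠ 0 := by
    intro h1
    rcases eq_or_ne X 0 with rfl | hne
    · simp at hX
    · exact absurd (h X h1 hne) (not_lt.2 hX.le)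
  -- The combination of `X` and `Y` orthogonal to `X₀`. The form must be positive on it unless it
  -- vanishes, but `B X Y = 0` makes `B Z Z` a sum of nonpositive terms.
  set Z := B X₀ Y • X - B X₀ X • Y with hZ
  have hZ0 : B X₀ Z = 0 := by
    simp only [hZ, map_sub, map_smul, smul_eq_mul]
    ring
  have hZZ : B Z Z = (B X₀ Y) ^ 2 * B X X + (B X₀ X) ^ 2 * B Y Y := by
    simp only [hZ, map_sub, map_smul, sub_apply, smul_apply, smul_eq_mul, hs Y X, hXY]
    ring
  have hZle : B Z Z ≤ 0 := by
    rw [hZZ]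
    nlinarith [mul_nonneg (sq_nonneg (B X₀ Y)) (neg_nonneg.2 hX.le),
      mul_nonneg (sq_nonneg (B X₀ X)) (neg_nonneg.2 hle)]
  have hZ' : Z = 0 := by
    by_contra hne
    exact absurd (h Z hZ0 hne) (not_lt.2 hZle)
  have h1 : B X Z = B X₀ Y * B X X := by
    simp only [hZ, map_sub, map_smul, smul_eq_mul, hXY]
    ring
  rw [hZ', map_zero] at h1
  have h2 : B X₀ Y = 0 := by
    rcases mul_eq_zero.1 h1.symm with h2 | h2
    · exact h2
    · exact absurd h2 hX.ne
  rw [h2, zero_smul, zero_sub, hZ', eq_comm, neg_eq_zero] at hZ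
  rcases smul_eq_zero.1 hZ with h3 | h3
  · exact ha h3
  · exact hY h3

/-- Two unit timelike vectors in the same half of the light cone. -/
lemma IsLorentzian.neg_of_future (hs : ∀ X Y, B X Y = B Y X) (hB : IsLorentzian B) {T N U : V}
    (hT : B T T < 0) (hN : B N N = -1) (hU : B U U = -1) (hTN : B T N < 0) (hTU : B T U < 0) :
    B N U < 0 := by
  have hpos : ∀ Y, B N Y = 0 → 0 ≤ B Y Y := by
    intro Y hY
    rcases eq_or_ne Y 0 with rfl | hne
    · simp
    · exact (hB.pos_of_orthogonal hs (by rw [hN]; norm_num) hY hne).le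
  by_contra! hNU
  have hTN' : B N T < 0 := by rwa [hs]
  have hTU' : B U T < 0 := by rwa [hs]
  set α := - B N T with hα
  set β := B N U with hβ
  have hUN : B U N = β := hs _ _
  have hTNα : B T N = -α := by rw [hs]; ring
  have hNTα : B N T = -α := by ring
  -- `T - α N` and `U + β N` are the projections of `T` and `U` orthogonal to `N`. With the weights
  -- `β` and `α` the terms `α² β²` cancel, leaving `B Y Y = β² B T T - α² + 2 α β B T U < 0`,
  -- against positivity on the complement of `N`.
  set Y := β • (T - α • N) + α • (U + β • N) with hYdef
  have hY : B N Y = 0 := by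
    simp only [hYdef, map_add, map_sub, map_smul, smul_eq_mul, hN, hNTα, ← hβ]
    ring
  have h1 := hpos Y hY
  have hYY : B Y Y = β ^ 2 * (B T T + α ^ 2) + α ^ 2 * (-1 + β ^ 2)
      + 2 * (α * β) * (B T U - α * β) := by
    simp only [hYdef, map_add, map_sub, map_smul, add_apply, sub_apply, smul_apply, smul_eq_mul,
      hN, hU, hs U T, hTNα, hNTα, hUN, ← hβ]
    ring
  rw [hYY] at h1
  have hα0 : 0 < α := by rw [hα]; linarith
  nlinarith [mul_nonneg (mul_nonneg hα0.le hNU) (neg_nonneg.2 hTU.le),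
    mul_nonneg (sq_nonneg β) (neg_nonneg.2 hT.le), mul_pos hα0 hα0]

lemma pullbackForm_apply (B : V →L[ℝ] V →L[ℝ] ℝ) (i : W →L[ℝ] V) (X Y : W) :
    pullbackForm B i X Y = B (i X) (i Y) := rfl

/-- In codimension one, every vector has a normal and a tangential component. -/
lemma exists_tangential [FiniteDimensional ℝ V] [FiniteDimensional ℝ W]
    {i : W →L[ℝ] V} {N : V} (hpos : ∀ X, X ≠ 0 → 0 < pullbackForm B i X X) (hN : B N N = -1)
    (hNi : ∀ X, B N (i X) = 0) (hdim : Module.finrank ℝ V = Module.finrank ℝ W + 1) (Z : V) :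
    ∃ w, Z = (-B N Z) • N + i w := by
  let f : (ℝ × W) →ₗ[ℝ] V :=
    ((LinearMap.toSpanSingleton ℝ V N).coprod i.toLinearMap)
  have hf : ∀ c w, f (c, w) = c • N + i w := fun c w => by simp [f]
  have hinj : Function.Injective f := by
    rw [← LinearMap.ker_eq_bot, LinearMap.ker_eq_bot']
    rintro ⟨c, w⟩ h
    rw [hf] at h
    have h1 := congrArg (B N) h
    simp only [map_add, map_smul, hN, hNi, smul_eq_mul, map_zero] at h1
    have hc : c = 0 := by linarith
    rw [hc, zero_smul, zero_add] at h
    have hw : w = 0 := by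
      by_contra hne
      have := hpos w hne
      rw [pullbackForm_apply, h] at this
      simp at this
    rw [hc, hw]
    rfl
  have hsurj : Function.Surjective f := by
    refine (LinearMap.injective_iff_surjective_of_finrank_eq_finrank ?_).1 hinj
    rw [Module.finrank_prod, Module.finrank_self, hdim, add_comm]
  obtain ⟨⟨c, w⟩, rfl⟩ := hsurj Z
  refine ⟨w, ?_⟩
  rw [hf]
  simp [hN, hNi]

/-- The trace of an endomorphism, split along a hypersurface. -/
lemma trace_eq_normal_add_tangential [FiniteDimensional ℝ V] [FiniteDimensional ℝ W]
    {i : W →L[ℝ] V} {N : V} (hNi : ∀ X, B N (i X) = 0)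
    (hinv : (pullbackForm B i).IsInvertible) (hdec : ∀ Z, ∃ w, Z = (-B N Z) • N + i w)
    (L : V →ₗ[ℝ] V) (Q : W →ₗ[ℝ] W) (hQ : ∀ X Y, B (i (Q X)) (i Y) = B (L (i X)) (i Y)) :
    LinearMap.trace ℝ V L = - B N (L N) + LinearMap.trace ℝ W Q := by
  -- Orthogonal projection onto the image of `i`, read back in `W`.
  let P : V →ₗ[ℝ] W := (pullbackForm B i).inverse.toLinearMap ∘ₗ
    (ContinuousLinearMap.precomp ℝ i).toLinearMap ∘ₗ B.toLinearMap
  have hP : ∀ Z w, (∀ Y, B Z (i Y) = B (i w) (i Y)) → P Z = w := by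
    intro Z w h
    have h1 : (ContinuousLinearMap.precomp ℝ i) (B Z) = pullbackForm B i w := by
      ext Y
      exact h Y
    change (pullbackForm B i).inverse ((ContinuousLinearMap.precomp ℝ i) (B Z)) = w
    rw [h1]
    exact hinv.inverse_apply_self w
  have hPQ : P ∘ₗ L ∘ₗ i.toLinearMap = Q := by
    ext X
    exact hP _ _ fun Y => (hQ X Y).symm
  -- The first summand has rank at most one and trace `-B N (L N)`; cyclicity of the trace turns the
  -- second into `P ∘ L ∘ i = Q`.
  have hL : L = (B N).toLinearMap.smulRight (-(L N)) + (L ∘ₗ i.toLinearMap) ∘ₗ P := by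
    ext Z
    obtain ⟨w, hw⟩ := hdec Z
    have h2 : P Z = w := by
      refine hP _ _ fun Y => ?_
      rw [hw]
      simp [hNi]
    have h3 := congrArg L hw
    rw [map_add, map_smul] at h3
    simp only [LinearMap.add_apply, LinearMap.smulRight_apply, LinearMap.comp_apply, h2]
    rw [h3]
    simp
  have htr : LinearMap.trace ℝ V ((L ∘ₗ i.toLinearMap) ∘ₗ P) = LinearMap.trace ℝ W Q := by
    rw [LinearMap.trace_comp_comm', hPQ]
  conv_lhs => rw [hL]
  rw [map_add, htr, LinearMap.trace_smulRight]
  simp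

end LinearAlgebra

/-! ### Invertibility and differentiability of the coordinate expressions. -/

section Regularity

variable {E : Type*} [NormedAddCommGroup E] [NormedSpace ℝ E]
  {M : Type*} [TopologicalSpace M] [ChartedSpace E M] [IsManifold 𝓘(ℝ, E) ∞ M]
  {F : Type*} [NormedAddCommGroup F] [NormedSpace ℝ F]
  {S : Type*} [TopologicalSpace S] [ChartedSpace F S] [IsManifold 𝓘(ℝ, F) ∞ S]
  {g : BilinField E M} {ι : S → M} {p : S}

lemma isInvertible_metricCoord [FiniteDimensional ℝ E] {x y : M}
    (h : ∀ X, (∀ Y, g y X Y = 0) → X = 0) (hy : y ∈ (chartAt E x).source) :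
    (metricCoord g x y).IsInvertible := by
  refine isInvertible_of_nondegenerate _ fun a ha => ?_
  have h1 : frame x y a = 0 := h _ fun Y => by
    have := ha (coord x y Y)
    rwa [metricCoord_apply, frame_coord hy] at this
  rw [← coord_frame hy a, h1, map_zero]

lemma isInvertible_form [FiniteDimensional ℝ E] {x : M}
    (h : ∀ X, (∀ Y, g x X Y = 0) → X = 0) : (g x).IsInvertible :=
  isInvertible_of_nondegenerate (E := E) (g x) h

/-- The hypothesis concerns a section of the bundle of bilinear forms; near `x`, its trivialization
consists of the components of `g` in the chart at `x`. -/
lemma mdifferentiableAt_metricCoord {x : M} (hg : ContMDiffAt 𝓘(ℝ, E)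
      (𝓘(ℝ, E).prod 𝓘(ℝ, E →L[ℝ] E →L[ℝ] ℝ)) 1
      (fun x => Bundle.TotalSpace.mk' (E →L[ℝ] E →L[ℝ] ℝ)
        (E := fun x : M => TangentSpace 𝓘(ℝ, E) x →L[ℝ] TangentSpace 𝓘(ℝ, E) x →L[ℝ] ℝ)
        x (g x)) x) :
    MDifferentiableAt 𝓘(ℝ, E) 𝓘(ℝ, E →L[ℝ] E →L[ℝ] ℝ) (metricCoord g x) x := by
  rw [contMDiffAt_hom_bundle] at hg
  refine (hg.2.mdifferentiableAt (by norm_num)).congr_of_eventuallyEq ?_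
  filter_upwards [(chartAt E x).open_source.mem_nhds (mem_chart_source E x)] with y hy
  ext a b
  have hy' : y ∈ (trivializationAt E (TangentSpace 𝓘(ℝ, E) : M → Type _) x).baseSet := by
    simpa using hy
  have := inCoordinates_apply_eq₂ (𝕜 := ℝ) (F₁ := E) (F₂ := E) (F₃ := ℝ)
    (E₁ := fun x : M => TangentSpace 𝓘(ℝ, E) x) (E₂ := fun x : M => TangentSpace 𝓘(ℝ, E) x)
    (E₃ := Bundle.Trivial M ℝ) (x₀ := x) (x := y) (ϕ := g y) (v := a) (w := b) hy' hy'
    (Set.mem_univ _)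
  refine Eq.trans ?_ this.symm
  rw [metricCoord_apply, frame, Bundle.Trivialization.symmL_apply _ hy',
    Bundle.Trivialization.symmL_apply _ hy']
  simp

lemma mdifferentiableAt_coord_along {N : ∀ q : S, TangentSpace 𝓘(ℝ, E) (ι q)}
    (hN : ContMDiffAt 𝓘(ℝ, F) 𝓘(ℝ, E).tangent 1
      (fun q => (⟨ι q, N q⟩ : TangentBundle 𝓘(ℝ, E) M)) p) :
    MDifferentiableAt 𝓘(ℝ, F) 𝓘(ℝ, E) (fun q => coord (ι p) (ι q) (N q)) p := by
  rw [Bundle.contMDiffAt_totalSpace] at hN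
  refine (hN.2.mdifferentiableAt (by norm_num)).congr_of_eventuallyEq ?_
  filter_upwards [hN.1.continuousAt.eventually
    ((chartAt E (ι p)).open_source.mem_nhds (mem_chart_source E (ι p)))] with q hq
  have hq' : ι q ∈ (trivializationAt E (TangentSpace 𝓘(ℝ, E) : M → Type _) (ι p)).baseSet := by
    simpa using (show ι q ∈ (chartAt E (ι p)).source from hq)
  simp only [coord, Bundle.Trivialization.continuousLinearMapAt_apply]
  rw [Bundle.Trivialization.coe_linearMapAt_of_mem _ hq']

/-- The tangential part of a differentiable field along `ι` is differentiable. -/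
lemma mdifferentiableAt_raise_along [CompleteSpace F]
    (hg : MDifferentiableAt 𝓘(ℝ, E) 𝓘(ℝ, E →L[ℝ] E →L[ℝ] ℝ) (metricCoord g (ι p)) (ι p))
    (hι : ContMDiffAt 𝓘(ℝ, F) 𝓘(ℝ, E) 2 ι p)
    (hh : ∀ᶠ q in nhds p, (metricCoord (pullbackField (F := F) g ι) p q).IsInvertible)
    {V : ∀ q : S, TangentSpace 𝓘(ℝ, E) (ι q)}
    (hV : MDifferentiableAt 𝓘(ℝ, F) 𝓘(ℝ, E) (fun q => coord (ι p) (ι q) (V q)) p)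
    {v : VecField F S} (hv : ∀ q (Y : TangentSpace 𝓘(ℝ, F) q),
      pullbackField g ι q (v q) Y = g (ι q) (V q) (mfderiv 𝓘(ℝ, F) 𝓘(ℝ, E) ι q Y)) :
    MDifferentiableAt 𝓘(ℝ, F) 𝓘(ℝ, F) (fun q => coord p q (v q)) p := by
  have hH := mdifferentiableAt_metricCoord_pullbackField hg hι
  have hG := mdifferentiableAt_metricCoord_comp hg hι
  have hD := mdifferentiableAt_jacobian hι
  -- The tangential part is `h⁻¹` applied to `g(V, dι ·)`, and inversion of operators is smooth at
  -- invertible ones; this uses completeness of `F`.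
  have hinv : MDifferentiableAt 𝓘(ℝ, F) 𝓘(ℝ, (F →L[ℝ] ℝ) →L[ℝ] F)
      (fun q => (metricCoord (pullbackField (F := F) g ι) p q).inverse) p :=
    ((hh.self_of_nhds.contDiffAt_map_inverse (n := 1)).differentiableAt
      (by norm_num)).comp_mdifferentiableAt hH
  have hα := mdifferentiableAt_bilin (ContinuousLinearMap.compL ℝ F E ℝ)
    (mdifferentiableAt_clm_apply hG hV) hD
  refine (mdifferentiableAt_clm_apply hinv hα).congr_of_eventuallyEq ?_
  filter_upwards [eventually_frame_coord_comp (E := E) hι.continuousAt,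
    eventually_frame_coord (E := F) p, hh] with q hq hq' hhq
  have : ContinuousLinearMap.compL ℝ F E ℝ
      (metricCoord g (ι p) (ι q) (coord (ι p) (ι q) (V q))) (jacobian E F ι p q)
      = metricCoord (pullbackField (F := F) g ι) p q (coord p q (v q)) := by
    ext a
    rw [metricCoord_apply, hq'.1, hv]
    change metricCoord g (ι p) (ι q) _ (jacobian E F ι p q a) = _
    rw [metricCoord_apply, hq, jacobian_apply, hq]
  rw [this]
  exact (hhq.inverse_apply_self _).symm

end Regularity

/-! ### Symmetry of the second fundamental form. -/

section SecondForm

variable {E : Type*} [NormedAddCommGroup E] [NormedSpace ℝ E]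
  {M : Type*} [TopologicalSpace M] [ChartedSpace E M] [IsManifold 𝓘(ℝ, E) ∞ M]
  {F : Type*} [NormedAddCommGroup F] [NormedSpace ℝ F]
  {S : Type*} [TopologicalSpace S] [ChartedSpace F S] [IsManifold 𝓘(ℝ, F) ∞ S]
  {g : BilinField E M} {ι : S → M} {p : S}

/-- The second fundamental form is symmetric. -/
lemma metric_covDerivAlong_symm (hs : ∀ y X Y, g y X Y = g y Y X)
    (hg : MDifferentiableAt 𝓘(ℝ, E) 𝓘(ℝ, E →L[ℝ] E →L[ℝ] ℝ) (metricCoord g (ι p)) (ι p))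
    (hi : (metricCoord g (ι p) (ι p)).IsInvertible)
    (hι : ContMDiffAt 𝓘(ℝ, F) 𝓘(ℝ, E) 2 ι p)
    {N : ∀ q : S, TangentSpace 𝓘(ℝ, E) (ι q)}
    (hN : MDifferentiableAt 𝓘(ℝ, F) 𝓘(ℝ, E) (fun q => coord (ι p) (ι q) (N q)) p)
    (hNι : ∀ q (Y : TangentSpace 𝓘(ℝ, F) q),
      g (ι q) (N q) (mfderiv 𝓘(ℝ, F) 𝓘(ℝ, E) ι q Y) = 0)
    (X Y : TangentSpace 𝓘(ℝ, F) p) :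
    g (ι p) (covDerivAlong g ι N p X) (mfderiv 𝓘(ℝ, F) 𝓘(ℝ, E) ι p Y)
      = g (ι p) (covDerivAlong g ι N p Y) (mfderiv 𝓘(ℝ, F) 𝓘(ℝ, E) ι p X) := by
  have hG := mdifferentiableAt_metricCoord_comp hg hι
  have hD := mdifferentiableAt_jacobian hι
  have along : ∀ X Y : TangentSpace 𝓘(ℝ, F) p,
      g (ι p) (covDerivAlong g ι N p X) (mfderiv 𝓘(ℝ, F) 𝓘(ℝ, E) ι p Y)
        = metricCoord g (ι p) (ι p) (mvfderiv 𝓘(ℝ, F) (fun q => coord (ι p) (ι q) (N q)) p X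
          + christoffel g (ι p) (jacobian E F ι p p (coord p p X)) (coord (ι p) (ι p) (N p)))
            (jacobian E F ι p p (coord p p Y)) := by
    intro X Y
    rw [metricCoord_apply, jacobian_coord_self, jacobian_coord_self, frame_coord_self]
    rfl
  -- Differentiate `g(N, dι Y) = 0` along `X`, with `Y` of constant components in the chart at `p`.
  -- The second derivative of `ι` that appears is symmetric in `X` and `Y`.
  have hdiff : ∀ X Y : TangentSpace 𝓘(ℝ, F) p,
      metricPartial g (ι p) (jacobian E F ι p p (coord p p X)) (coord (ι p) (ι p) (N p))
          (jacobian E F ι p p (coord p p Y))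
        + metricCoord g (ι p) (ι p) (mvfderiv 𝓘(ℝ, F) (fun q => coord (ι p) (ι q) (N q)) p X)
          (jacobian E F ι p p (coord p p Y))
        + metricCoord g (ι p) (ι p) (coord (ι p) (ι p) (N p))
          (mvfderiv 𝓘(ℝ, F) (jacobian E F ι p) p (frame p p (coord p p X)) (coord p p Y)) = 0 := by
    intro X Y
    have h0 : (fun q => metricCoord g (ι p) (ι q) (coord (ι p) (ι q) (N q))
        (jacobian E F ι p q (coord p p Y))) =ᶠ[nhds p] fun _ => (0 : ℝ) := by
      filter_upwards [eventually_frame_coord_comp (E := E) hι.continuousAt] with q hq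
      rw [metricCoord_apply, jacobian_apply, hq, hq, hNι]
    have hc : MDifferentiableAt 𝓘(ℝ, F) 𝓘(ℝ, F) (fun _ : S => coord p p Y) p :=
      mdifferentiableAt_const
    have h1 : mvfderiv 𝓘(ℝ, F) (fun q => metricCoord g (ι p) (ι q)) p X
        = metricPartial g (ι p) (jacobian E F ι p p (coord p p X)) := by
      rw [mvfderiv_comp_mfderiv hg (hι.mdifferentiableAt (by norm_num)), jacobian_coord_self]
      simp [metricPartial, frame_coord_self]
    have h2 := congrArg (fun L => L X) (mvfderiv_congr h0)
    rw [mvfderiv_const] at h2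
    simp only [zero_apply] at h2
    rw [mvfderiv_clm_apply (mdifferentiableAt_clm_apply hG hN) (mdifferentiableAt_clm_apply hD hc),
      mvfderiv_clm_apply hG hN, mvfderiv_clm_apply hD hc, mvfderiv_const, h1] at h2
    rw [frame_coord_self]
    simpa using h2
  have hXY := hdiff X Y
  have hYX := hdiff Y X
  rw [mvfderiv_jacobian_symm hι] at hYX
  have hp := metricPartial_symm hs hg
  rw [along, along]
  simp only [map_add, add_apply, metricCoord_christoffel hi, christoffelLow_apply]
  rw [hp (coord (ι p) (ι p) (N p)) (jacobian E F ι p p (coord p p X)),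
    hp (jacobian E F ι p p (coord p p Y)) (jacobian E F ι p p (coord p p X)),
    hp (jacobian E F ι p p (coord p p X)) (jacobian E F ι p p (coord p p Y))]
  linarith

end SecondForm

/-! ### Weyl derivatives in terms of Levi-Civita derivatives. -/

section Weyl

variable {E : Type*} [NormedAddCommGroup E] [NormedSpace ℝ E]
  {M : Type*} [TopologicalSpace M] [ChartedSpace E M] [IsManifold 𝓘(ℝ, E) ∞ M]
  {g : BilinField E M} {x : M}

lemma metric_raise (hi : (g x).IsInvertible) (α : TangentSpace 𝓘(ℝ, E) x →L[ℝ] ℝ)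
    (Y : TangentSpace 𝓘(ℝ, E) x) : g x (raise g x α) Y = α Y := by
  rw [raise, hi.self_apply_inverse]

/-- The Weyl derivative of `V_a` of weight `-1` in terms of the Levi-Civita derivative. -/
lemma weylForm_lower (hs : ∀ y X Y, g y X Y = g y Y X)
    (hg : MDifferentiableAt 𝓘(ℝ, E) 𝓘(ℝ, E →L[ℝ] E →L[ℝ] ℝ) (metricCoord g x) x)
    (hc : (metricCoord g x x).IsInvertible) (hi : (g x).IsInvertible) {V : VecField E M}
    (hV : MDifferentiableAt 𝓘(ℝ, E) 𝓘(ℝ, E) (fun y => coord x y (V y)) x)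
    (A : OneForm E M) (X Y : TangentSpace 𝓘(ℝ, E) x) :
    weylForm g A (-1) (lower g V) x X Y
      = g x (covDeriv g V x X) Y - g x X Y * A x (V x) + A x Y * g x (V x) X := by
  have h1 : g x (V x) (raise g x (A x)) = A x (V x) := by rw [hs, metric_raise hi]
  rw [weylForm, covDerivForm_lower hs hg hc hV]
  simp only [lower, weylC, sub_apply, ContinuousLinearMap.smulRight_apply, smul_apply,
    ContinuousLinearMap.id_apply, map_sub, map_smul, smul_eq_mul, h1]
  ring

/-- The Weyl divergence of a vector field of weight `1` in dimension three. -/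
lemma trace_weylVec [FiniteDimensional ℝ E] (hE : Module.finrank ℝ E = 3)
    (hs : ∀ y X Y, g y X Y = g y Y X) (hi : (g x).IsInvertible) (A : OneForm E M)
    (V : VecField E M) :
    LinearMap.trace ℝ _ (weylVec g A 1 V x)
      = LinearMap.trace ℝ _ (covDeriv g V x) - 2 * A x (V x) := by
  have : FiniteDimensional ℝ (TangentSpace 𝓘(ℝ, E) x) := inferInstanceAs (FiniteDimensional ℝ E)
  have hdim : Module.finrank ℝ (TangentSpace 𝓘(ℝ, E) x) = 3 := hE
  -- At weight `1` the term `A(X) V` cancels against one in `C`. What remains has trace `A(V) - 3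
  -- A(V)` in dimension three.
  have h : weylVec g A 1 V x = covDeriv g V x
      + (g x (V x)).toLinearMap.smulRight (raise g x (A x)) - A x (V x) • LinearMap.id := by
    ext X
    simp only [weylVec, weylC, LinearMap.coe_mk, AddHom.coe_mk, LinearMap.sub_apply,
      LinearMap.add_apply, LinearMap.smulRight_apply, LinearMap.smul_apply, LinearMap.id_apply,
      sub_apply, ContinuousLinearMap.smulRight_apply, smul_apply, ContinuousLinearMap.id_apply,
      ContinuousLinearMap.coe_coe, hs x (V x) X]
    module
  rw [h, map_sub, map_add, map_smul, LinearMap.trace_smulRight, LinearMap.trace_id, hdim]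
  simp only [ContinuousLinearMap.coe_coe, smul_eq_mul, hs x (V x), metric_raise hi]
  push_cast
  ring

end Weyl

/-! ### The shear tensor of the fluid. -/

section Shear

variable {M : Type*} [TopologicalSpace M] [ChartedSpace (Model 4) M] [IsManifold (𝓡 4) ∞ M]
  {g : LorentzianMetric M} {t : TimeOrientation g} {u : VecField (Model 4) M}

lemma LorentzianMetric.isLorentzian (g : LorentzianMetric M) (x : M) : IsLorentzian (g.form x) :=
  g.signature x

lemma LorentzianMetric.nondegenerate (g : LorentzianMetric M) (x : M) (X : TangentSpace (𝓡 4) x)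
    (h : ∀ Y, g.form x X Y = 0) : X = 0 :=
  (g.isLorentzian x).nondegenerate (g.symm x) X h

lemma LorentzianMetric.isInvertible_metricCoord (g : LorentzianMetric M) (x : M) :
    (metricCoord g.form x x).IsInvertible :=
  ConformalFluid.isInvertible_metricCoord (g.nondegenerate x) (mem_chart_source _ x)

lemma LorentzianMetric.isInvertible (g : LorentzianMetric M) (x : M) :
    (g.form x).IsInvertible :=
  isInvertible_form (g.nondegenerate x)

lemma LorentzianMetric.mdifferentiableAt (g : LorentzianMetric M) (x : M) :
    MDifferentiableAt (𝓡 4) 𝓘(ℝ, Model 4 →L[ℝ] Model 4 →L[ℝ] ℝ) (metricCoord g.form x) x :=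
  mdifferentiableAt_metricCoord (g.contMDiff x)

lemma IsFluidVelocity.mdifferentiableAt (hu : IsFluidVelocity g t u) (x : M) :
    MDifferentiableAt (𝓡 4) 𝓘(ℝ, Model 4) (fun y => coord x y (u y)) x :=
  mdifferentiableAt_coord_along (ι := id) (hu.contMDiff x)

lemma IsFluidVelocity.metric_covDeriv (hu : IsFluidVelocity g t u) (x : M)
    (X : TangentSpace (𝓡 4) x) : g.form x (covDeriv g.form u x X) (u x) = 0 :=
  metric_covDeriv_self g.symm (g.mdifferentiableAt x) (g.isInvertible_metricCoord x)
    (hu.mdifferentiableAt x) (fun y => (hu.unit y).1) X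

lemma IsFluidVelocity.fluidA_apply (hu : IsFluidVelocity g t u) (x : M)
    (Y : TangentSpace (𝓡 4) x) :
    fluidA g.form u x Y = g.form x (covDeriv g.form u x (u x)) Y
      - 1 / 3 * LinearMap.trace ℝ _ (covDeriv g.form u x) * g.form x (u x) Y := by
  rw [fluidA, sub_apply, smul_apply, covDerivForm_lower g.symm (g.mdifferentiableAt x)
    (g.isInvertible_metricCoord x) (hu.mdifferentiableAt x)]
  rfl

lemma IsFluidVelocity.fluidA_self (hu : IsFluidVelocity g t u) (x : M) :
    fluidA g.form u x (u x) = 1 / 3 * LinearMap.trace ℝ _ (covDeriv g.form u x) := by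
  rw [hu.fluidA_apply, hu.metric_covDeriv, (hu.unit x).1]
  ring

/-- Removes the Weyl connection; the later shear computations start from this bilinear expression in
`∇u` and `A`. -/
lemma IsFluidVelocity.shear_apply (hu : IsFluidVelocity g t u) (x : M)
    (X Y : TangentSpace (𝓡 4) x) :
    shear g.form u x X Y = 1 / 2 * (g.form x (covDeriv g.form u x X) Y
        + g.form x (covDeriv g.form u x Y) X) - fluidA g.form u x (u x) * g.form x X Y
      + 1 / 2 * (fluidA g.form u x Y * g.form x (u x) X
        + fluidA g.form u x X * g.form x (u x) Y) := by
  have h := weylForm_lower g.symm (g.mdifferentiableAt x) (g.isInvertible_metricCoord x)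
    (g.isInvertible x) (hu.mdifferentiableAt x) (fluidA g.form u)
  rw [shear, h, h, g.symm x Y X]
  ring

/-- The shear tensor is orthogonal to the fluid velocity. -/
lemma IsFluidVelocity.shear_self (hu : IsFluidVelocity g t u) (x : M)
    (Y : TangentSpace (𝓡 4) x) : shear g.form u x (u x) Y = 0 := by
  -- The form of `A` is what makes this vanish: its acceleration part cancels `∇_u u`, and its
  -- expansion part cancels the terms in `A(u)`.
  rw [hu.shear_apply, hu.metric_covDeriv, (hu.unit x).1, hu.fluidA_self, hu.fluidA_apply x Y]
  ring

lemma IsFluidVelocity.shear_comm (hu : IsFluidVelocity g t u) (x : M)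
    (X Y : TangentSpace (𝓡 4) x) : shear g.form u x X Y = shear g.form u x Y X := by
  rw [hu.shear_apply, hu.shear_apply, g.symm x Y X]
  ring

lemma IsFluidVelocity.shear_smul_add (hu : IsFluidVelocity g t u) (x : M) (r : ℝ)
    (X Z Y : TangentSpace (𝓡 4) x) :
    shear g.form u x (r • X + Z) Y = r * shear g.form u x X Y + shear g.form u x Z Y := by
  simp only [hu.shear_apply, map_add, map_smul, add_apply, smul_apply, smul_eq_mul]
  ring

end Shear

/-! ### Splitting the velocity, its divergence and its shear along the hypersurface. -/

section Hypersurface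

variable {M : Type*} [TopologicalSpace M] [ChartedSpace (Model 4) M] [IsManifold (𝓡 4) ∞ M]
  {S : Type*} [TopologicalSpace S] [ChartedSpace (Model 3) S] [IsManifold (𝓡 3) ∞ S]
  {g : LorentzianMetric M} {t : TimeOrientation g} {u : VecField (Model 4) M}
  {ι : S → M} {N : ∀ p : S, TangentSpace (𝓡 4) (ι p)}

lemma inducedMetric_apply (g : BilinField (Model 4) M) (ι : S → M) (p : S)
    (X Y : TangentSpace (𝓡 3) p) :
    inducedMetric g ι p X Y
      = g (ι p) (mfderiv (𝓡 3) (𝓡 4) ι p X) (mfderiv (𝓡 3) (𝓡 4) ι p Y) := rfl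

lemma inducedMetric_symm (g : LorentzianMetric M) (ι : S → M) (p : S)
    (X Y : TangentSpace (𝓡 3) p) :
    inducedMetric g.form ι p X Y = inducedMetric g.form ι p Y X := g.symm _ _ _

lemma IsSpacelike.nondegenerate (hι : IsSpacelike g ι) (p : S) (X : TangentSpace (𝓡 3) p)
    (h : ∀ Y, inducedMetric g.form ι p X Y = 0) : X = 0 := by
  by_contra hne
  exact (hι.pos p X hne).ne' (h X)

lemma IsSpacelike.isInvertible (hι : IsSpacelike g ι) (p : S) :
    (inducedMetric g.form ι p).IsInvertible :=
  isInvertible_form (hι.nondegenerate p)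

lemma IsSpacelike.isInvertible_metricCoord (hι : IsSpacelike g ι) (p : S) :
    (metricCoord (inducedMetric g.form ι) p p).IsInvertible :=
  ConformalFluid.isInvertible_metricCoord (hι.nondegenerate p) (mem_chart_source _ p)

lemma IsSpacelike.mdifferentiableAt_metricCoord (hι : IsSpacelike g ι) (p : S) :
    MDifferentiableAt (𝓡 3) 𝓘(ℝ, Model 3 →L[ℝ] Model 3 →L[ℝ] ℝ)
      (metricCoord (inducedMetric g.form ι) p) p :=
  mdifferentiableAt_metricCoord_pullbackField (g.mdifferentiableAt (ι p)) (hι.contMDiff p)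

lemma IsSpacelike.mdifferentiableAt (hι : IsSpacelike g ι) (p : S) :
    MDifferentiableAt (𝓡 3) (𝓡 4) ι p :=
  (hι.contMDiff p).mdifferentiableAt (by norm_num)

lemma IsSpacelike.inducedMetric_sliceV (hι : IsSpacelike g ι) (u : VecField (Model 4) M) (p : S)
    (Y : TangentSpace (𝓡 3) p) :
    inducedMetric g.form ι p (sliceV g.form u ι p) Y
      = g.form (ι p) (u (ι p)) (mfderiv (𝓡 3) (𝓡 4) ι p Y) :=
  metric_raise (hι.isInvertible p) _ Y

lemma mdifferentiableAt_velocity_along (hι : IsSpacelike g ι) (hu : IsFluidVelocity g t u)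
    (p : S) : MDifferentiableAt (𝓡 3) 𝓘(ℝ, Model 4) (fun q => coord (ι p) (ι q) (u (ι q))) p :=
  MDifferentiableAt.comp p (hu.mdifferentiableAt (ι p)) (hι.mdifferentiableAt p)

lemma mdifferentiableAt_sliceV (hι : IsSpacelike g ι) (hu : IsFluidVelocity g t u) (p : S) :
    MDifferentiableAt (𝓡 3) 𝓘(ℝ, Model 3) (fun q => coord p q (sliceV g.form u ι q)) p := by
  refine mdifferentiableAt_raise_along (V := fun q => u (ι q)) (g.mdifferentiableAt (ι p))
    (hι.contMDiff p) ?_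
    (mdifferentiableAt_velocity_along hι hu p) (hι.inducedMetric_sliceV u)
  filter_upwards [(chartAt (Model 3) p).open_source.mem_nhds (mem_chart_source _ p)] with q hq
  exact ConformalFluid.isInvertible_metricCoord (hι.nondegenerate q) hq

lemma exists_tangential_slice (hι : IsSpacelike g ι) (hN : IsFutureUnitNormal g t ι N) (p : S)
    (Z : TangentSpace (𝓡 4) (ι p)) :
    ∃ w, Z = (- g.form (ι p) (N p) Z) • N p + mfderiv (𝓡 3) (𝓡 4) ι p w := by
  have : FiniteDimensional ℝ (TangentSpace (𝓡 4) (ι p)) :=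
    inferInstanceAs (FiniteDimensional ℝ (Model 4))
  have : FiniteDimensional ℝ (TangentSpace (𝓡 3) p) :=
    inferInstanceAs (FiniteDimensional ℝ (Model 3))
  have h4 : Module.finrank ℝ (TangentSpace (𝓡 4) (ι p)) = 4 :=
    finrank_euclideanSpace_fin (𝕜 := ℝ) (n := 4)
  have h3 : Module.finrank ℝ (TangentSpace (𝓡 3) p) = 3 :=
    finrank_euclideanSpace_fin (𝕜 := ℝ) (n := 3)
  exact exists_tangential (hι.pos p) (hN.unit p).1 (hN.normal p) (by rw [h4, h3]) Z

/-- The sign that makes `-g(N, u)` the positive square root `γ`; this is how the time orientation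
enters. -/
lemma metric_normal_velocity_neg (hN : IsFutureUnitNormal g t ι N) (hu : IsFluidVelocity g t u)
    (p : S) : g.form (ι p) (N p) (u (ι p)) < 0 :=
  (g.isLorentzian (ι p)).neg_of_future (g.symm (ι p)) (t.timelike (ι p)) (hN.unit p).1
    (hu.unit (ι p)).1 (hN.unit p).2 (hu.unit (ι p)).2

lemma velocity_eq_normal_add (hι : IsSpacelike g ι) (hN : IsFutureUnitNormal g t ι N) (p : S) :
    u (ι p) = (- g.form (ι p) (N p) (u (ι p))) • N p
      + mfderiv (𝓡 3) (𝓡 4) ι p (sliceV g.form u ι p) := by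
  obtain ⟨w, hw⟩ := exists_tangential_slice hι hN p (u (ι p))
  have h : sliceV g.form u ι p - w = 0 := by
    refine hι.nondegenerate p _ fun Y => ?_
    rw [map_sub, sub_apply, hι.inducedMetric_sliceV, hw, map_add, map_smul, add_apply, smul_apply,
      hN.normal, inducedMetric_apply]
    simp
  rw [sub_eq_zero.1 h]
  exact hw

lemma sliceGamma_eq (hι : IsSpacelike g ι) (hN : IsFutureUnitNormal g t ι N)
    (hu : IsFluidVelocity g t u) (p : S) :
    sliceGamma g.form u ι p = - g.form (ι p) (N p) (u (ι p)) := by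
  have h := velocity_eq_normal_add (u := u) hι hN p
  have h1 := (hu.unit (ι p)).1
  set a := - g.form (ι p) (N p) (u (ι p)) with ha
  have hNs : ∀ Y, g.form (ι p) (mfderiv (𝓡 3) (𝓡 4) ι p Y) (N p) = 0 := fun Y => by
    rw [g.symm, hN.normal]
  rw [h] at h1
  simp only [map_add, map_smul, add_apply, smul_apply, smul_eq_mul, (hN.unit p).1, hN.normal,
    hNs, ← inducedMetric_apply] at h1
  have h2 : 1 + sliceNormSq g.form u ι p = a ^ 2 := by
    rw [sliceNormSq]
    linarith
  rw [sliceGamma, h2, Real.sqrt_sq]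
  have := metric_normal_velocity_neg hN hu p
  linarith

lemma sliceGamma_pos (hι : IsSpacelike g ι) (hN : IsFutureUnitNormal g t ι N)
    (hu : IsFluidVelocity g t u) (p : S) : 0 < sliceGamma g.form u ι p := by
  rw [sliceGamma_eq hι hN hu]
  have := metric_normal_velocity_neg hN hu p
  linarith

lemma sliceNormSq_nonneg (hι : IsSpacelike g ι) (u : VecField (Model 4) M) (p : S) :
    0 ≤ sliceNormSq g.form u ι p := by
  rw [sliceNormSq]
  rcases eq_or_ne (sliceV g.form u ι p) 0 with h | h
  · simp [h]
  · exact (hι.pos p _ h).le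

lemma sliceGamma_sq (hι : IsSpacelike g ι) (u : VecField (Model 4) M) (p : S) :
    sliceGamma g.form u ι p ^ 2 = 1 + sliceNormSq g.form u ι p :=
  Real.sq_sqrt (by linarith [sliceNormSq_nonneg hι u p])

/-- The decomposition `u^a = γ N^a + v^a`. -/
lemma velocity_decomposition (hι : IsSpacelike g ι) (hN : IsFutureUnitNormal g t ι N)
    (hu : IsFluidVelocity g t u) (p : S) :
    u (ι p) = sliceGamma g.form u ι p • N p
      + mfderiv (𝓡 3) (𝓡 4) ι p (sliceV g.form u ι p) := by
  rw [sliceGamma_eq hι hN hu]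
  exact velocity_eq_normal_add hι hN p

/-- The formula `γ = -g(N, u)` avoids the square root and leaves a product of differentiable
factors. -/
lemma mdifferentiableAt_sliceGamma (hι : IsSpacelike g ι) (hN : IsFutureUnitNormal g t ι N)
    (hu : IsFluidVelocity g t u) (p : S) :
    MDifferentiableAt (𝓡 3) 𝓘(ℝ, ℝ) (sliceGamma g.form u ι) p := by
  have hG := mdifferentiableAt_metricCoord_comp (g.mdifferentiableAt (ι p)) (hι.contMDiff p)
  have h := mdifferentiableAt_clm_apply (mdifferentiableAt_clm_apply hG
    (mdifferentiableAt_coord_along (hN.contMDiff p))) (mdifferentiableAt_velocity_along hι hu p)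
  refine h.neg.congr_of_eventuallyEq ?_
  filter_upwards [eventually_frame_coord_comp (E := Model 4) (hι.contMDiff p).continuousAt]
    with q hq
  rw [sliceGamma_eq hι hN hu, Pi.neg_apply, metricCoord_apply, hq, hq]

lemma secondForm_symm (hι : IsSpacelike g ι) (hN : IsFutureUnitNormal g t ι N) (p : S)
    (X Y : TangentSpace (𝓡 3) p) :
    secondForm g.form ι N p X Y = secondForm g.form ι N p Y X :=
  metric_covDerivAlong_symm g.symm (g.mdifferentiableAt (ι p))
    (g.isInvertible_metricCoord (ι p)) (hι.contMDiff p)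
    (mdifferentiableAt_coord_along (hN.contMDiff p)) hN.normal X Y

/-- The tangential components of the derivative of the fluid velocity. -/
lemma metric_covDeriv_velocity (hι : IsSpacelike g ι) (hN : IsFutureUnitNormal g t ι N)
    (hu : IsFluidVelocity g t u) (p : S) (X Y : TangentSpace (𝓡 3) p) :
    g.form (ι p) (covDeriv g.form u (ι p) (mfderiv (𝓡 3) (𝓡 4) ι p X))
        (mfderiv (𝓡 3) (𝓡 4) ι p Y)
      = sliceGamma g.form u ι p * secondForm g.form ι N p X Y
        + inducedMetric g.form ι p
          (covDeriv (inducedMetric g.form ι) (sliceV g.form u ι) p X) Y := by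
  rw [← covDerivAlong_restrict (hu.mdifferentiableAt (ι p)) (hι.mdifferentiableAt p)]
  have h : (fun q => u (ι q)) = fun q => sliceGamma g.form u ι q • N q
      + mfderiv (𝓡 3) (𝓡 4) ι q (sliceV g.form u ι q) :=
    funext (velocity_decomposition hι hN hu)
  rw [h]
  exact metric_covDerivAlong_add g.symm (g.mdifferentiableAt (ι p))
    (g.isInvertible_metricCoord (ι p)) (hι.isInvertible_metricCoord p) (hι.contMDiff p)
    (mdifferentiableAt_sliceGamma hι hN hu p) (mdifferentiableAt_coord_along (hN.contMDiff p))
    (mdifferentiableAt_sliceV hι hu p) X Y (hN.normal p Y)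

/-- The divergence of the fluid velocity, split along the hypersurface. -/
lemma trace_covDeriv_velocity (hι : IsSpacelike g ι) (hN : IsFutureUnitNormal g t ι N)
    (hu : IsFluidVelocity g t u) (p : S) :
    LinearMap.trace ℝ _ (covDeriv g.form u (ι p))
      = - g.form (ι p) (covDeriv g.form u (ι p) (N p)) (N p)
        + sliceGamma g.form u ι p * meanCurvature g.form ι N p
        + LinearMap.trace ℝ _ (covDeriv (inducedMetric g.form ι) (sliceV g.form u ι) p) := by
  have : FiniteDimensional ℝ (TangentSpace (𝓡 4) (ι p)) :=
    inferInstanceAs (FiniteDimensional ℝ (Model 4))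
  have : FiniteDimensional ℝ (TangentSpace (𝓡 3) p) :=
    inferInstanceAs (FiniteDimensional ℝ (Model 3))
  have h := trace_eq_normal_add_tangential (B := g.form (ι p)) (i := mfderiv (𝓡 3) (𝓡 4) ι p)
    (hN.normal p) (hι.isInvertible p) (exists_tangential_slice hι hN p)
    (covDeriv g.form u (ι p))
    (sliceGamma g.form u ι p •
        ((inducedMetric g.form ι p).inverse.toLinearMap ∘ₗ secondForm g.form ι N p)
      + covDeriv (inducedMetric g.form ι) (sliceV g.form u ι) p) (fun X Y => by
      rw [metric_covDeriv_velocity hι hN hu, ← inducedMetric_apply, LinearMap.add_apply, map_add,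
        add_apply, LinearMap.smul_apply, map_smul, smul_apply, LinearMap.comp_apply,
        ContinuousLinearMap.coe_coe, (hι.isInvertible p).self_apply_inverse, smul_eq_mul])
  rw [h, map_add, map_smul, g.symm _ (N p), meanCurvature, smul_eq_mul]
  ring

/-- The tangential components of the shear tensor. -/
lemma shear_tangential (hι : IsSpacelike g ι) (hN : IsFutureUnitNormal g t ι N)
    (hu : IsFluidVelocity g t u) (p : S) (X Y : TangentSpace (𝓡 3) p) :
    shear g.form u (ι p) (mfderiv (𝓡 3) (𝓡 4) ι p X) (mfderiv (𝓡 3) (𝓡 4) ι p Y)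
      = sliceStrain g.form u ι N p X Y
        + 1 / 3 * shear g.form u (ι p) (N p) (N p) * inducedMetric g.form ι p X Y := by
  have hw := weylForm_lower (inducedMetric_symm g ι) (hι.mdifferentiableAt_metricCoord p)
    (hι.isInvertible_metricCoord p) (hι.isInvertible p) (mdifferentiableAt_sliceV hι hu p)
    (sliceA g.form u ι)
  have ht := trace_weylVec (x := p) (finrank_euclideanSpace_fin (𝕜 := ℝ) (n := 3))
    (inducedMetric_symm g ι) (hι.isInvertible p) (sliceA g.form u ι) (sliceV g.form u ι)
  have hA : ∀ X, sliceA g.form u ι p X = fluidA g.form u (ι p) (mfderiv (𝓡 3) (𝓡 4) ι p X) :=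
    fun _ => rfl
  have hAu : fluidA g.form u (ι p) (u (ι p))
      = sliceGamma g.form u ι p * fluidA g.form u (ι p) (N p)
        + fluidA g.form u (ι p) (mfderiv (𝓡 3) (𝓡 4) ι p (sliceV g.form u ι p)) := by
    conv_lhs => rw [velocity_decomposition hι hN hu p]
    simp
  have hγ : g.form (ι p) (u (ι p)) (N p) = - sliceGamma g.form u ι p := by
    rw [sliceGamma_eq hι hN hu, g.symm]
    ring
  have hθ := trace_covDeriv_velocity hι hN hu p
  have hθA := hu.fluidA_self (ι p)
  rw [hu.shear_apply, hu.shear_apply, metric_covDeriv_velocity hι hN hu,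
    metric_covDeriv_velocity hι hN hu, ← hι.inducedMetric_sliceV, ← hι.inducedMetric_sliceV,
    ← inducedMetric_apply, secondForm_symm hι hN p Y X, sliceStrain, tracefreeForm, sliceShear,
    sliceVLow, hw, hw, ht, hA, hA, hA, hγ, (hN.unit p).1, inducedMetric_symm g ι p Y X]
  -- Only multiples of `h` are left to compare. Splitting `A(u)` and `div u`, and `A(u) = div u /
  -- 3`, identify them; this encodes that `σ` is trace-free.
  linear_combination (-1 / 3 * inducedMetric g.form ι p X Y) * hAu
    - (inducedMetric g.form ι p X Y) * hθA
    - (1 / 3 * inducedMetric g.form ι p X Y) * hθ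

end Hypersurface

/-! ### Normal components of shear and heat flux, and the two densities. -/

section Densities

variable {M : Type*} [TopologicalSpace M] [ChartedSpace (Model 4) M] [IsManifold (𝓡 4) ∞ M]
  {S : Type*} [TopologicalSpace S] [ChartedSpace (Model 3) S] [IsManifold (𝓡 3) ∞ S]
  {g : LorentzianMetric M} {t : TimeOrientation g} {u : VecField (Model 4) M}
  {ι : S → M} {N : ∀ p : S, TangentSpace (𝓡 4) (ι p)}

/-- Expand `σ(u, Y) = 0` along `u = γ N + v` and insert `shear_tangential` for `σ(v, Y)`. -/
lemma shear_normal_tangential (hι : IsSpacelike g ι) (hN : IsFutureUnitNormal g t ι N)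
    (hu : IsFluidVelocity g t u) (p : S) (Y : TangentSpace (𝓡 3) p) :
    sliceGamma g.form u ι p
        * shear g.form u (ι p) (N p) (mfderiv (𝓡 3) (𝓡 4) ι p Y)
      = - (sliceStrain g.form u ι N p (sliceV g.form u ι p) Y
        + 1 / 3 * shear g.form u (ι p) (N p) (N p) * sliceVLow g.form u ι p Y) := by
  have h := hu.shear_self (ι p) (mfderiv (𝓡 3) (𝓡 4) ι p Y)
  rw [velocity_decomposition hι hN hu p] at h
  rw [hu.shear_smul_add, shear_tangential hι hN hu] at h
  rw [sliceVLow, lower]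
  linarith

/-- The normal component of the shear tensor. -/
lemma shear_normal_normal (hι : IsSpacelike g ι) (hN : IsFutureUnitNormal g t ι N)
    (hu : IsFluidVelocity g t u) (p : S) :
    (1 + 2 * sliceGamma g.form u ι p ^ 2) * shear g.form u (ι p) (N p) (N p)
      = 3 * sliceStrain g.form u ι N p (sliceV g.form u ι p) (sliceV g.form u ι p) := by
  have h := hu.shear_self (ι p) (N p)
  rw [velocity_decomposition hι hN hu p] at h
  rw [hu.shear_smul_add, hu.shear_comm _ (mfderiv (𝓡 3) (𝓡 4) ι p _)] at h
  have h1 := shear_normal_tangential hι hN hu p (sliceV g.form u ι p)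
  have h2 := sliceGamma_sq hι u p
  have h3 : sliceVLow g.form u ι p (sliceV g.form u ι p) = sliceNormSq g.form u ι p := rfl
  rw [h3] at h1
  -- Here `γ² σ(N, N) = F(v, v) + |v|² σ(N, N) / 3`, and `3 γ² - |v|² = 1 + 2 γ²`.
  linear_combination (3 * sliceGamma g.form u ι p) * h - 3 * h1
    - shear g.form u (ι p) (N p) (N p) * h2

/-- On scalars the Weyl derivative involves no metric, only `df` and the one-form, and both pull
back. -/
lemma weylScalar_restrict (hι : IsSpacelike g ι) (u : VecField (Model 4) M) (w : ℝ) {f : M → ℝ}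
    (hf : MDifferentiable (𝓡 4) 𝓘(ℝ, ℝ) f) (p : S) (X : TangentSpace (𝓡 3) p) :
    sliceD g.form u ι w f p X
      = weylScalar (fluidA g.form u) w f (ι p) (mfderiv (𝓡 3) (𝓡 4) ι p X) := by
  have h := mvfderiv_comp_mfderiv (hf (ι p)) (hι.mdifferentiableAt p) X
  change mvfderiv (𝓡 3) (fun q => f (ι q)) p X + _ = _
  rw [h]
  rfl

/-- The projected derivative annihilates `u = γ N + v`, so `γ` times its normal component is minus
its component along `v`. -/
lemma perpD_normal (hι : IsSpacelike g ι) (hN : IsFutureUnitNormal g t ι N)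
    (hu : IsFluidVelocity g t u) (w : ℝ) {f : M → ℝ}
    (hf : MDifferentiable (𝓡 4) 𝓘(ℝ, ℝ) f) (p : S) :
    sliceGamma g.form u ι p * perpD g.form u w f (ι p) (N p)
      = - sliceHeat g.form u ι w f p (sliceV g.form u ι p) := by
  have hγ : g.form (ι p) (u (ι p)) (N p) = - sliceGamma g.form u ι p := by
    rw [sliceGamma_eq hι hN hu, g.symm]
    ring
  have h1 : flowD g.form u w f (ι p)
      = sliceGamma g.form u ι p * weylScalar (fluidA g.form u) w f (ι p) (N p)
        + weylScalar (fluidA g.form u) w f (ι p)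
          (mfderiv (𝓡 3) (𝓡 4) ι p (sliceV g.form u ι p)) := by
    rw [flowD]
    rw [velocity_decomposition hι hN hu p]
    rw [map_add, map_smul, smul_eq_mul]
  have h3 : sliceVLow g.form u ι p (sliceV g.form u ι p) = sliceNormSq g.form u ι p := rfl
  have h2 := sliceGamma_sq hι u p
  rw [perpD, lower, hγ, map_add, map_smul, smul_eq_mul, ← flowD, sliceHeat, h3,
    weylScalar_restrict hι u w hf]
  linear_combination -h1 - flowD g.form u w f (ι p) * h2

lemma perpD_tangential (hι : IsSpacelike g ι) (u : VecField (Model 4) M) (w : ℝ) {f : M → ℝ}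
    (hf : MDifferentiable (𝓡 4) 𝓘(ℝ, ℝ) f) (p : S) (Y : TangentSpace (𝓡 3) p) :
    perpD g.form u w f (ι p) (mfderiv (𝓡 3) (𝓡 4) ι p Y) = sliceHeat g.form u ι w f p Y := by
  rw [perpD, lower, ← hι.inducedMetric_sliceV, map_add, map_smul, smul_eq_mul, ← flowD, sliceHeat,
    weylScalar_restrict hι u w hf]
  rfl

/-- Since `u_a N^a = -γ`, the perfect-fluid part contributes `γ² + (γ² - 1) / 3 = 1 + 4 |v|² / 3`.
-/
lemma energyDensity_eq (hι : IsSpacelike g ι) (hN : IsFutureUnitNormal g t ι N)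
    (hu : IsFluidVelocity g t u) {ε : M → ℝ} (hε : MDifferentiable (𝓡 4) 𝓘(ℝ, ℝ) ε)
    (hpos : ∀ x, 0 < ε x) (cε cχ cη cl : ℝ) (p : S) :
    energyDensity (stressEnergy g.form u ε cε cχ cη cl) ι N p
      = (ε (ι p) + viscosity cχ cε (ε (ι p)) * (3 * flowD g.form u 4 ε (ι p) / (4 * ε (ι p))))
          * (1 + 4 / 3 * sliceNormSq g.form u ι p)
        - viscosity cη cε (ε (ι p)) * (6 / (1 + 2 * sliceGamma g.form u ι p ^ 2))
          * sliceStrain g.form u ι N p (sliceV g.form u ι p) (sliceV g.form u ι p)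
        + viscosity cl cε (ε (ι p)) / (2 * ε (ι p))
          * sliceHeat g.form u ι 4 ε p (sliceV g.form u ι p) := by
  have hγ : g.form (ι p) (u (ι p)) (N p) = - sliceGamma g.form u ι p := by
    rw [sliceGamma_eq hι hN hu, g.symm]
    ring
  have h1 := shear_normal_normal hι hN hu p
  have h2 := perpD_normal hι hN hu 4 hε p
  have h3 := sliceGamma_sq hι u p
  have hden : 1 + 2 * sliceGamma g.form u ι p ^ 2 ≠ 0 := by positivity
  have h4 : sliceStrain g.form u ι N p (sliceV g.form u ι p) (sliceV g.form u ι p)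
      = (1 + 2 * sliceGamma g.form u ι p ^ 2) * shear g.form u (ι p) (N p) (N p) / 3 := by
    rw [h1]; ring
  have h5 : sliceHeat g.form u ι 4 ε p (sliceV g.form u ι p)
      = - (sliceGamma g.form u ι p * perpD g.form u 4 ε (ι p) (N p)) := by rw [h2]; ring
  have h6 : sliceNormSq g.form u ι p = sliceGamma g.form u ι p ^ 2 - 1 := by rw [h3]; ring
  have hε0 := (hpos (ι p)).ne'
  rw [energyDensity, stressEnergy, lower, hγ, (hN.unit p).1, h4, h5, h6]
  field_simp
  ring

/-- The projection sends `N` to `N + g(N, N) N = 0`. As `N` and the tangential vectors span, the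
tangential components then determine `J`. -/
lemma momentumDensity_normal (hN : IsFutureUnitNormal g t ι N)
    (hu : IsFluidVelocity g t u) (ε : M → ℝ) (cε cχ cη cl : ℝ) (p : S) :
    momentumDensity g.form (stressEnergy g.form u ε cε cχ cη cl) ι N p (N p) = 0 := by
  rw [momentumDensity, (hN.unit p).1]
  simp [stressEnergy, hu.shear_apply, perpD, lower]

lemma momentumDensity_tangential (hι : IsSpacelike g ι) (hN : IsFutureUnitNormal g t ι N)
    (hu : IsFluidVelocity g t u) {ε : M → ℝ} (hε : MDifferentiable (𝓡 4) 𝓘(ℝ, ℝ) ε)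
    (hpos : ∀ x, 0 < ε x) (cε cχ cη cl : ℝ) (p : S) (Y : TangentSpace (𝓡 3) p) :
    momentumDensity g.form (stressEnergy g.form u ε cε cχ cη cl) ι N p
        (mfderiv (𝓡 3) (𝓡 4) ι p Y)
      = (ε (ι p) + viscosity cχ cε (ε (ι p)) * (3 / 4) * (flowD g.form u 4 ε (ι p) / ε (ι p)))
          * (4 * sliceGamma g.form u ι p / 3) * sliceVLow g.form u ι p Y
        - viscosity cη cε (ε (ι p)) * (2 / sliceGamma g.form u ι p)
          * (sliceStrain g.form u ι N p (sliceV g.form u ι p) Y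
            + sliceVLow g.form u ι p Y / (1 + 2 * sliceGamma g.form u ι p ^ 2)
              * sliceStrain g.form u ι N p (sliceV g.form u ι p) (sliceV g.form u ι p))
        + viscosity cl cε (ε (ι p)) * (sliceGamma g.form u ι p / (4 * ε (ι p)))
          * (sliceHeat g.form u ι 4 ε p Y
            + sliceVLow g.form u ι p Y / sliceGamma g.form u ι p ^ 2
              * sliceHeat g.form u ι 4 ε p (sliceV g.form u ι p)) := by
  have hγ : g.form (ι p) (u (ι p)) (N p) = - sliceGamma g.form u ι p := by
    rw [sliceGamma_eq hι hN hu, g.symm]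
    ring
  have hγ0 := (sliceGamma_pos hι hN hu p).ne'
  have hden : 1 + 2 * sliceGamma g.form u ι p ^ 2 ≠ 0 := by positivity
  have hε0 := (hpos (ι p)).ne'
  have hv : g.form (ι p) (u (ι p)) (mfderiv (𝓡 3) (𝓡 4) ι p Y) = sliceVLow g.form u ι p Y :=
    (hι.inducedMetric_sliceV u p Y).symm
  have h1 : sliceStrain g.form u ι N p (sliceV g.form u ι p) (sliceV g.form u ι p)
      = (1 + 2 * sliceGamma g.form u ι p ^ 2) * shear g.form u (ι p) (N p) (N p) / 3 := by
    rw [shear_normal_normal hι hN hu p]; ring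
  have h2 : sliceHeat g.form u ι 4 ε p (sliceV g.form u ι p)
      = - (sliceGamma g.form u ι p * perpD g.form u 4 ε (ι p) (N p)) := by
    rw [perpD_normal hι hN hu 4 hε p]; ring
  have h3 : sliceStrain g.form u ι N p (sliceV g.form u ι p) Y
      = - (sliceGamma g.form u ι p
          * shear g.form u (ι p) (N p) (mfderiv (𝓡 3) (𝓡 4) ι p Y))
        - 1 / 3 * shear g.form u (ι p) (N p) (N p) * sliceVLow g.form u ι p Y := by
    rw [shear_normal_tangential hι hN hu p Y]; ring
  rw [momentumDensity, hN.normal, zero_smul, add_zero, stressEnergy, lower, hγ, hN.normal, hv,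
    perpD_tangential hι u 4 hε, h1, h2, h3]
  field_simp
  ring

end Densities

/-! ### Passing from energy density to temperature. -/

section Temperature

variable {M : Type*} [TopologicalSpace M] [ChartedSpace (Model 4) M] [IsManifold (𝓡 4) ∞ M]
  {ε T : M → ℝ} {cε : ℝ}

lemma viscosity_temperature (c : ℝ) (hcε : 0 < cε) {T : ℝ} (hT : 0 < T) :
    viscosity c cε (cε * T ^ 4) = c * T ^ 3 := by
  rw [viscosity, mul_div_cancel_left₀ _ hcε.ne', ← Real.rpow_natCast T 4, ← Real.rpow_mul hT.le]
  norm_num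

/-- No regularity of `T` is assumed: it is inherited from `ε` through the fourth root, which is
smooth away from zero. -/
lemma mdifferentiable_temperature (hcε : 0 < cε) (hε : MDifferentiable (𝓡 4) 𝓘(ℝ, ℝ) ε)
    (hT : ∀ x, 0 < T x) (hεT : ∀ x, ε x = cε * T x ^ 4) :
    MDifferentiable (𝓡 4) 𝓘(ℝ, ℝ) T := by
  have h : T = (fun s : ℝ => (s / cε) ^ (1 / 4 : ℝ)) ∘ ε := by
    funext x
    rw [Function.comp_apply, hεT, mul_div_cancel_left₀ _ hcε.ne', ← Real.rpow_natCast (T x) 4,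
      ← Real.rpow_mul (hT x).le]
    norm_num
  intro x
  rw [h]
  have h0 : ε x / cε ≠ 0 := by
    rw [hεT, mul_div_cancel_left₀ _ hcε.ne']
    exact (pow_pos (hT x) 4).ne'
  have hd : DifferentiableAt ℝ (fun s : ℝ => (s / cε) ^ (1 / 4 : ℝ)) (ε x) :=
    (differentiableAt_id.div_const cε).rpow_const (Or.inl h0)
  exact hd.comp_mdifferentiableAt (hε x)

/-- The weights obey the power rule as well: the term `4 A ε` is `4 cε T³` times the term `A T`. -/
lemma weylScalar_temperature (A : OneForm (Model 4) M)
    (hTd : MDifferentiable (𝓡 4) 𝓘(ℝ, ℝ) T) (hεT : ∀ x, ε x = cε * T x ^ 4) (x : M)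
    (X : TangentSpace (𝓡 4) x) :
    weylScalar A 4 ε x X = 4 * cε * T x ^ 3 * weylScalar A 1 T x X := by
  have hd : mvfderiv (𝓡 4) ε x X = 4 * cε * T x ^ 3 * mvfderiv (𝓡 4) T x X := by
    have h : ε = (fun s : ℝ => cε * s ^ 4) ∘ T := funext hεT
    have h1 : HasDerivAt (fun s : ℝ => cε * s ^ 4) (cε * (4 * T x ^ 3)) (T x) := by
      simpa using (hasDerivAt_pow 4 (T x)).const_mul cε
    have h2 : MDifferentiableAt 𝓘(ℝ, ℝ) 𝓘(ℝ, ℝ) (fun s : ℝ => cε * s ^ 4) (T x) :=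
      h1.differentiableAt.mdifferentiableAt
    have h3 := mvfderiv_comp_mfderiv h2 (hTd x) X
    have h4 : mvfderiv 𝓘(ℝ, ℝ) (fun s : ℝ => cε * s ^ 4) (T x) (mvfderiv (𝓡 4) T x X)
        = mvfderiv (𝓡 4) T x X * (cε * (4 * T x ^ 3)) := by
      have h5 : mvfderiv 𝓘(ℝ, ℝ) (fun s : ℝ => cε * s ^ 4) (T x)
          = fderiv ℝ (fun s : ℝ => cε * s ^ 4) (T x) := mfderiv_eq_fderiv
      refine (congrArg (fun L : ℝ →L[ℝ] ℝ => L (mvfderiv (𝓡 4) T x X))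
        (h5.trans h1.hasFDerivAt.fderiv)).trans ?_
      simp
    rw [h]
    refine (h3.trans h4).trans ?_
    ring
  simp only [weylScalar, add_apply, smul_apply, smul_eq_mul, hd, hεT x]
  ring

lemma flowD_temperature (g : BilinField (Model 4) M) (u : VecField (Model 4) M)
    (hTd : MDifferentiable (𝓡 4) 𝓘(ℝ, ℝ) T) (hεT : ∀ x, ε x = cε * T x ^ 4) (x : M) :
    flowD g u 4 ε x = 4 * cε * T x ^ 3 * flowD g u 1 T x :=
  weylScalar_temperature _ hTd hεT x _

lemma sliceHeat_temperature {S : Type*} [TopologicalSpace S] [ChartedSpace (Model 3) S]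
    [IsManifold (𝓡 3) ∞ S] {g : LorentzianMetric M} {ι : S → M} (hι : IsSpacelike g ι)
    (u : VecField (Model 4) M) (hε : MDifferentiable (𝓡 4) 𝓘(ℝ, ℝ) ε)
    (hTd : MDifferentiable (𝓡 4) 𝓘(ℝ, ℝ) T) (hεT : ∀ x, ε x = cε * T x ^ 4) (p : S)
    (X : TangentSpace (𝓡 3) p) :
    sliceHeat g.form u ι 4 ε p X = 4 * cε * T (ι p) ^ 3 * sliceHeat g.form u ι 1 T p X := by
  rw [sliceHeat, sliceHeat, weylScalar_restrict hι u 4 hε, weylScalar_restrict hι u 1 hTd,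
    weylScalar_temperature _ hTd hεT, flowD_temperature _ _ hTd hεT]
  ring

end Temperature

end ConformalFluid

end

/-! ### The energy and momentum densities. -/

theorem proposition4p6
    {M : Type*} [TopologicalSpace M] [ChartedSpace (ConformalFluid.Model 4) M]
    [IsManifold (𝓡 4) ∞ M]
    {S : Type*} [TopologicalSpace S] [ChartedSpace (ConformalFluid.Model 3) S]
    [IsManifold (𝓡 3) ∞ S]
    (g : ConformalFluid.LorentzianMetric M) (t : ConformalFluid.TimeOrientation g)
    (ι : S → M) (hι : ConformalFluid.IsSpacelike g ι)
    (N : ∀ p : S, TangentSpace (𝓡 4) (ι p)) (hN : ConformalFluid.IsFutureUnitNormal g t ι N)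
    (u : ConformalFluid.VecField (ConformalFluid.Model 4) M)
    (hu : ConformalFluid.IsFluidVelocity g t u)
    (ε : M → ℝ) (hε : ContMDiff (𝓡 4) 𝓘(ℝ, ℝ) 1 ε) (hε_pos : ∀ x, 0 < ε x)
    (cε cχ cη cl : ℝ) (hcε : 0 < cε) :
    let T4 := ConformalFluid.stressEnergy g.form u ε cε cχ cη cl
    let 𝓔 : S → ℝ := ConformalFluid.energyDensity T4 ι N
    let J := ConformalFluid.momentumDensity g.form T4 ι N
    let χ : S → ℝ := fun p => ConformalFluid.viscosity cχ cε (ε (ι p))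
    let η : S → ℝ := fun p => ConformalFluid.viscosity cη cε (ε (ι p))
    let lam : S → ℝ := fun p => ConformalFluid.viscosity cl cε (ε (ι p))
    let v := ConformalFluid.sliceV g.form u ι
    let vLow := ConformalFluid.sliceVLow g.form u ι
    let vSq : S → ℝ := ConformalFluid.sliceNormSq g.form u ι
    let γ : S → ℝ := ConformalFluid.sliceGamma g.form u ι
    -- `F_{ab} = γ θ_{ab} + σ^Σ_{ab}`
    let F := ConformalFluid.sliceStrain g.form u ι N
    -- `D ε` and `D^Σ_a ε + v_a D ε`
    let Dε : S → ℝ := fun p => ConformalFluid.flowD g.form u 4 ε (ι p)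
    let Qε := ConformalFluid.sliceHeat g.form u ι 4 ε
    (∀ p : S,
      𝓔 p = (ε (ι p) + χ p * (3 * Dε p / (4 * ε (ι p)))) * (1 + 4 / 3 * vSq p)
        - η p * (6 / (1 + 2 * γ p ^ 2)) * F p (v p) (v p)
        + lam p / (2 * ε (ι p)) * Qε p (v p)) ∧
    (∀ p : S, J p (N p) = 0) ∧
    (∀ (p : S) (Y : TangentSpace (𝓡 3) p),
      J p (mfderiv (𝓡 3) (𝓡 4) ι p Y) =
        (ε (ι p) + χ p * (3 / 4) * (Dε p / ε (ι p))) * (4 * γ p / 3) * vLow p Y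
        - η p * (2 / γ p)
          * (F p (v p) Y + vLow p Y / (1 + 2 * γ p ^ 2) * F p (v p) (v p))
        + lam p * (γ p / (4 * ε (ι p)))
          * (Qε p Y + vLow p Y / γ p ^ 2 * Qε p (v p))) ∧
    (∀ T : M → ℝ, (∀ x, 0 < T x) → (∀ x, ε x = cε * T x ^ 4) →
      -- `D T` and `D^Σ_a T + v_a D T`
      let DT : S → ℝ := fun p => ConformalFluid.flowD g.form u 1 T (ι p)
      let QT := ConformalFluid.sliceHeat g.form u ι 1 T
      (∀ p : S,
        𝓔 p = (cε * T (ι p) ^ 4 + 3 * cχ * T (ι p) ^ 2 * DT p) * (1 + 4 / 3 * vSq p)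
          - cη * T (ι p) ^ 3 * (6 / (1 + 2 * γ p ^ 2)) * F p (v p) (v p)
          + 2 * cl * T (ι p) ^ 2 * QT p (v p)) ∧
      (∀ (p : S) (Y : TangentSpace (𝓡 3) p),
        J p (mfderiv (𝓡 3) (𝓡 4) ι p Y) =
          (cε * T (ι p) ^ 4 + 3 * cχ * T (ι p) ^ 2 * DT p) * (4 * γ p / 3) * vLow p Y
          - 2 * cη * T (ι p) ^ 3 / γ p
            * (F p (v p) Y + vLow p Y / (1 + 2 * γ p ^ 2) * F p (v p) (v p))
          + cl * T (ι p) ^ 2 * γ p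
            * (QT p Y + vLow p Y / γ p ^ 2 * QT p (v p)))) := by
  have hεd : MDifferentiable (𝓡 4) 𝓘(ℝ, ℝ) ε := hε.mdifferentiable (by norm_num)
  intro T4 𝓔 J χ η lam v vLow vSq γ F Dε Qε
  have hE := ConformalFluid.energyDensity_eq hι hN hu hεd hε_pos cε cχ cη cl
  have hJ := ConformalFluid.momentumDensity_tangential hι hN hu hεd hε_pos cε cχ cη cl
  refine ⟨hE, ConformalFluid.momentumDensity_normal hN hu ε cε cχ cη cl, hJ, ?_⟩
  intro T hT hεT DT QT
  have hTd := ConformalFluid.mdifferentiable_temperature hcε hεd hT hεT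
  have hQ := ConformalFluid.sliceHeat_temperature hι u hεd hTd hεT
  have hD := ConformalFluid.flowD_temperature g.form u hTd hεT
  have hη := fun c p => ConformalFluid.viscosity_temperature c hcε (hT (ι p))
  refine ⟨fun p => ?_, fun p Y => ?_⟩
  · have hT0 := (hT (ι p)).ne'
    have hden : 1 + 2 * ConformalFluid.sliceGamma g.form u ι p ^ 2 ≠ 0 := by positivity
    refine (hE p).trans ?_
    -- For instance `χ · 3 Dε / (4ε)` becomes `cχ T³ · 3 DT / T = 3 cχ T² DT`, and `λ / (2ε) · 4 cε
    -- T³` becomes `2 cl T²`.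
    simp only [hQ, hD, hεT (ι p), hη, DT, QT, γ, F, v, vSq]
    field_simp
    ring
  · have hT0 := (hT (ι p)).ne'
    have hγ0 := (ConformalFluid.sliceGamma_pos hι hN hu p).ne'
    have hden : 1 + 2 * ConformalFluid.sliceGamma g.form u ι p ^ 2 ≠ 0 := by positivity
    refine (hJ p Y).trans ?_
    simp only [hQ, hD, hεT (ι p), hη, DT, QT, γ, F, v, vLow]
    field_simp
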